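/- Preferences are linear orders (votes) on a set of $m\ge 1$ candidates. For a vector $\alpha^{(m)}=(\alpha^{(m)}_1\ge\dots\ge\alpha^{(m)}_m)$ of non-negative integers for each $m$, the scoring rule of $\alpha$ gives a candidate $\alpha^{(m)}_i$ points for each vote that ranks it at position $i$, and the winners are the candidates with the largest total score; $\alpha^{(m)}=(m-1,m-2,\dots,1,0)$ is the Borda rule. For a voting rule $r$ and a polynomial $q$, consider the following problem, \textsc{Coalitional Manipulation} for $r$ with at most $q(m)$ manipulators, parameterized by the number $m$ of candidates: given a set of $m$ candidates, a list of votes (of the non-manipulators), a number $|M|\le q(m)$ of manipulators (empty votes) and a candidate $c$, can the manipulators cast $|M|$ votes such that $c$ is the unique winner under $r$ of the election that consists of all the votes? A parameterized problem $\Pi\subseteq\Gamma^*\times\mathbb N$ over a finite alphabet $\Gamma$ admits a polynomial kernel if there are a polynomial $g$ and an algorithm that maps each $(x,k)\in\Gamma^*\times\mathbb N$, in time polynomial in $|x|+k$, to a pair $(x',k')$ with $(x,k)\in\Pi\iff(x',k')\in\Pi$ and $|x'|,k'\le g(k)$. For every polynomial $q$, \textsc{Coalitional Manipulation} for the Borda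 rule with at most $q(m)$ manipulators, parameterized by $m$, admits a polynomial kernel. More generally, for every polynomial $q$ the same holds for each scoring rule with integer score vectors $\alpha^{(m)}$ as above such that: 1. for each $m\ge 2$ the vector $\alpha^{(m)}$ is normalized, that is, there is a $j<m$ with $\alpha^{(m)}_j-\alpha^{(m)}_{j+1}=1$ and $\alpha^{(m)}_k=0$ for all $k>j$; 2. $\alpha^{(m)}_1$ is bounded by a polynomial in $m$; 3. $\alpha^{(m+1)}_{i+1}=\alpha^{(m)}_i$ for all $m\ge 2$ and $1\le i\le m$; 4. the vector $\alpha^{(m)}$ can be computed in time polynomial in $m$ (from $m$ in unary). -/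

import Mathlib

/-! ### Parameterized problems and polynomial kernels -/

namespace Kernelization

/-- A pair `(x, k)`, written on a tape: the parameter `k` in unary (symbols `none`), followed by the
string `x`. Its length is `|x| + k`. -/
def encodePair {Γ : Type} (y : List Γ × ℕ) : List (Option Γ) :=
  List.replicate y.2 none ++ y.1.map some

/-- The parameterized problem `Q ⊆ Γ* × ℕ` over the finite alphabet `Γ` admits a polynomial kernel:
some function `(x, k) ↦ (x', k')`, computable by a Turing machine in time polynomial in `|x| + k`,
preserves membership in `Q`, and `|x'|` and `k'` are bounded by a polynomial in `k`. -/
def HasPolynomialKernel {Γ : Type} [Finite Γ] (Q : Set (List Γ × ℕ)) : Prop :=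
  ∃ f : List Γ × ℕ → List Γ × ℕ,
    Nonempty (Turing.TM2ComputableInPolyTime (encodePair (Γ := Γ)) (encodePair (Γ := Γ)) f) ∧
    (∀ y, y ∈ Q ↔ f y ∈ Q) ∧
    ∃ g : Polynomial ℕ, ∀ y, (f y).1.length ≤ g.eval y.2 ∧ (f y).2 ≤ g.eval y.2

end Kernelization

namespace Voting

/-! ### Votes, voting rules, scoring rules -/

/-- A vote (a linear order) on the candidates `0, …, m - 1`: `v i` is the candidate at position `i`,
position `0` being the most preferred; so `v.symm x` is the position of the candidate `x`. -/
abbrev Vote (m : ℕ) : Type := Equiv.Perm (Fin m)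

/-- A voting rule gives the set of winners of each profile of votes (with multiplicity), for each
number `m` of candidates. -/
abbrev Rule : Type := ∀ m : ℕ, List (Vote m) → Set (Fin m)

/-- A family of score vectors: `α m i` is the score of position `i` if there are `m` candidates. -/
abbrev ScoreVectors : Type := ∀ m : ℕ, Fin m → ℕ

/-- The score of the candidate `x` from the votes `P`. -/
def score (α : ScoreVectors) {m : ℕ} (P : List (Vote m)) (x : Fin m) : ℕ :=
  (P.map fun v => α m (v.symm x)).sum

/-- The positional scoring rule of `α`: the winners are the candidates with maximum score. -/
def scoringRule (α : ScoreVectors) : Rule :=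
  fun _ P => {x | ∀ y, score α P y ≤ score α P x}

/-- The Borda score vectors `(m - 1, m - 2, …, 1, 0)`. -/
def bordaVectors : ScoreVectors := fun m i => m - 1 - (i : ℕ)

/-- The Borda rule. -/
def borda : Rule := scoringRule bordaVectors

/-- A vector is normalized if for some `j` its entries at `j` and `j + 1` differ by exactly `1` and
all entries after `j` vanish. -/
def IsNormalized {m : ℕ} (a : Fin m → ℕ) : Prop :=
  ∃ j k : Fin m, (k : ℕ) = j + 1 ∧ a j = a k + 1 ∧ ∀ i, j < i → a i = 0

/-! ### Words -/

/-- The alphabet in which instances are written. -/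
inductive Sym : Type
  | tick
  | comma
  | semi
  deriving DecidableEq

instance : Fintype Sym := ⟨{Sym.tick, Sym.comma, Sym.semi}, fun s => by cases s <;> decide⟩

/-- A natural number in unary, closed by a comma. -/
def encodeNat (n : ℕ) : List Sym := List.replicate n Sym.tick ++ [Sym.comma]

/-- A list of numbers, closed by a semicolon. -/
def encodeRow (l : List ℕ) : List Sym := l.flatMap encodeNat ++ [Sym.semi]

/-! ### Scoring rules that the kernelization applies to -/

/-- Families of score vectors that are nonincreasing and normalized, with largest entry bounded by
a polynomial in the number `m` of candidates, such that the vector for `m + 1` candidates arises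
from the one for `m` candidates by putting one entry in front, and that can be computed in
polynomial time from `m` in unary. (No vector of length less than `2` is normalized.) -/
structure IsPolyExtensible (α : ScoreVectors) : Prop where
  antitone : ∀ m, Antitone (α m)
  normalized : ∀ m, 2 ≤ m → IsNormalized (α m)
  polyBounded : ∃ p : Polynomial ℕ, ∀ (m : ℕ) (h : 0 < m), α m ⟨0, h⟩ ≤ p.eval m
  extension : ∀ m, 2 ≤ m → ∀ i : Fin m, α (m + 1) i.succ = α m i
  computable : Nonempty (Turing.TM2ComputableInPolyTime
    (fun m : ℕ => List.replicate m Sym.tick) encodeRow (fun m : ℕ => List.ofFn (α m)))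

/-! ### Coalitional manipulation -/

/-- An instance of Coalitional Manipulation: the number `m` of candidates, the votes of the
non-manipulators, the number of manipulators (that is, of empty votes), and the candidate `c` whom
the manipulators want to win. -/
structure CMInstance where
  m : ℕ
  votes : List (Vote m)
  numManip : ℕ
  c : Fin m

/-- The manipulators can vote so that `c` is the unique winner under `r`. -/
def CMInstance.IsYes (r : Rule) (I : CMInstance) : Prop :=
  ∃ M : List (Vote I.m), M.length = I.numManip ∧ r I.m (I.votes ++ M) = {I.c}

/-- An instance as a string: a row with `m`, the number of manipulators and `c`, followed by one row
for each vote of a non-manipulator, listing the candidates from the most to the least preferred. -/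
def CMInstance.encode (I : CMInstance) : List Sym :=
  encodeRow [I.m, I.numManip, I.c] ++
    I.votes.flatMap fun v => encodeRow (List.ofFn fun i => (v i : ℕ))

/-- Coalitional Manipulation for `r`, parameterized by the number `m` of candidates, restricted to
instances with at most `q m` manipulators: the set of pairs `(x, k)` such that `x` encodes such an
instance with `k` candidates that has the answer yes. -/
def coalitionalManipulation (r : Rule) (q : Polynomial ℕ) : Set (List Sym × ℕ) :=
  {y | ∃ I : CMInstance, I.encode = y.1 ∧ I.m = y.2 ∧ I.numManip ≤ q.eval I.m ∧ I.IsYes r}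

end Voting

/-! Whether `c` can win depends only on the score differences between `c` and the other candidates
before the manipulators vote, and `t` manipulators cannot change a comparison once the difference
exceeds `t * a₀`, where `a₀` is the top score. Differences can therefore be cut off at that order of
magnitude, and an election with few votes realizing the truncated differences is an equivalent
instance.

To realize them, one dummy candidate is added. The hypotheses force every vector to end in `1, 0`.
All rotations of one vote give every candidate the same score; swapping the last two candidates in
the unrotated vote moves one point from the dummy to a chosen candidate (`exists_votes_raise`).
Repeating such blocks yields any prescribed bonuses over a common base `S`, while the dummy stays at
most at `S` (`exists_votes_kernelVotes`). Manipulators may be assumed to rank `c` first, and the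
dummy can be ranked second. Since the vector for `m + 1` candidates is the one for `m` with an entry
in front, the other candidates then score as before, and only the gain of `c` needs a correction
(`isYes_iff`). The number of new votes is polynomial in `m` because `t` and `a₀` are
(`length_kernelVotes_le`).

That the map is computable in polynomial time is proved on the level of Turing machines. Programs on
a few stacks operate on prefix codes of trees, and `PolyTime` functions are closed under
composition, pairing, case distinction and folds of controlled growth. This gives list operations,
unary arithmetic, parsing and the kernel itself. The machine that computes the score vectors is
embedded in the programs as an oracle (`PolyTime.oracle`), and `PolyTime.nonempty_computable` turns
a program back into a machine. -/

/-! ### Composable stack machines and their running times. -/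

namespace StackProgram

open Turing Voting

/-! ### Programs on stacks -/

/-- The stacks of a program, besides those of its oracle machine: one for input and output, the
main stack `a`, two auxiliary stacks `b` and `c`, and a counter `d`. -/
inductive Base : Type
  | io | a | b | c | d
  deriving DecidableEq

instance : Fintype Base :=
  ⟨{Base.io, Base.a, Base.b, Base.c, Base.d}, fun s => by cases s <;> decide⟩

/-- The labels of the leaves of a tree. -/
abbrev Label : Type := Option Sym

/-- The letters of the prefix code of a tree: `none` stands for an inner node. -/
abbrev Letter : Type := Option Label

variable (T : TM2ComputableAux Sym Sym)

/-- The stacks of a program with the oracle machine `T`. -/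
abbrev Idx : Type := Base ⊕ T.tm.K

/-- The alphabets of the stacks. -/
abbrev Alph : Idx T → Type
  | .inl .io => Label
  | .inl .a => Letter
  | .inl .b => Letter
  | .inl .c => Letter
  | .inl .d => Unit
  | .inr k => T.tm.Γ k

/-- The internal states: the letter that was read last, and a state of the oracle machine. -/
abbrev Var : Type := Option Letter × T.tm.σ

/-- The statements of programs. -/
abbrev PStmt (Λ : Type) : Type := TM2.Stmt (Alph T) Λ (Var T)

/-- The contents of all stacks. -/
abbrev Store : Type := ∀ k : Idx T, List (Alph T k)

variable {T}

/-- The store with the given stacks. -/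
def stk (io : List Label) (a b c : List Letter) (d : List Unit) (R : ∀ k, List (T.tm.Γ k)) :
    Store T
  | .inl .io => io
  | .inl .a => a
  | .inl .b => b
  | .inl .c => c
  | .inl .d => d
  | .inr k => R k

section stk

variable (io : List Label) (a b c : List Letter) (d : List Unit) (R : ∀ k, List (T.tm.Γ k))

@[simp] theorem stk_io : stk io a b c d R (.inl .io) = io := rfl
@[simp] theorem stk_a : stk io a b c d R (.inl .a) = a := rfl
@[simp] theorem stk_b : stk io a b c d R (.inl .b) = b := rfl
@[simp] theorem stk_c : stk io a b c d R (.inl .c) = c := rfl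
@[simp] theorem stk_d : stk io a b c d R (.inl .d) = d := rfl
@[simp] theorem stk_inr (k) : stk io a b c d R (.inr k) = R k := rfl

@[simp] theorem update_stk_io (x : List Label) :
    Function.update (stk io a b c d R) (.inl .io) x = stk x a b c d R := by
  funext k; rcases k with (_ | _ | _ | _ | _) | k <;> simp [Function.update]

@[simp] theorem update_stk_a (x : List Letter) :
    Function.update (stk io a b c d R) (.inl .a) x = stk io x b c d R := by
  funext k; rcases k with (_ | _ | _ | _ | _) | k <;> simp [Function.update]

@[simp] theorem update_stk_b (x : List Letter) :
    Function.update (stk io a b c d R) (.inl .b) x = stk io a x c d R := by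
  funext k; rcases k with (_ | _ | _ | _ | _) | k <;> simp [Function.update]

@[simp] theorem update_stk_c (x : List Letter) :
    Function.update (stk io a b c d R) (.inl .c) x = stk io a b x d R := by
  funext k; rcases k with (_ | _ | _ | _ | _) | k <;> simp [Function.update]

@[simp] theorem update_stk_d (x : List Unit) :
    Function.update (stk io a b c d R) (.inl .d) x = stk io a b c x R := by
  funext k; rcases k with (_ | _ | _ | _ | _) | k <;> simp [Function.update]

@[simp] theorem update_stk_inr (k : T.tm.K) (x : List (T.tm.Γ k)) :
    Function.update (stk io a b c d R) (.inr k) x = stk io a b c d (Function.update R k x) := by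
  funext j
  rcases j with (_ | _ | _ | _ | _) | j
  any_goals simp [Function.update]
  by_cases h : j = k
  · subst h; simp
  · simp [h]

end stk

/-- The store in which all stacks but the main stack are empty. -/
abbrev main (A : List Letter) : Store T := stk [] A [] [] [] fun _ => []

/-! ### Runs -/

section Reach

variable {K : Type} [DecidableEq K] {Γ : K → Type} {Λ Λ' σ : Type}

/-- `Reach M n c c'`: the machine `M` gets from `c` to `c'` in exactly `n` steps. -/
inductive Reach (M : Λ → TM2.Stmt Γ Λ σ) : ℕ → TM2.Cfg Γ Λ σ → TM2.Cfg Γ Λ σ → Prop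
  | refl (c) : Reach M 0 c c
  | head {n l v S c} : Reach M n (TM2.stepAux (M l) v S) c → Reach M (n + 1) ⟨some l, v, S⟩ c

namespace Reach

variable {M : Λ → TM2.Stmt Γ Λ σ} {n k : ℕ} {c₁ c₂ c₃ : TM2.Cfg Γ Λ σ}

theorem trans (h : Reach M n c₁ c₂) (h' : Reach M k c₂ c₃) : Reach M (n + k) c₁ c₃ := by
  induction h with
  | refl => simpa using h'
  | head _ ih => rw [Nat.add_right_comm]; exact (ih h').head

theorem cons {l v S} (h : TM2.stepAux (M l) v S = c₁) (h' : Reach M n c₁ c₂) :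
    Reach M (n + 1) ⟨some l, v, S⟩ c₂ :=
  (h ▸ h').head

theorem single {l v S} (h : TM2.stepAux (M l) v S = c₂) : Reach M 1 ⟨some l, v, S⟩ c₂ :=
  h ▸ (refl _).head

theorem iterate_eq (h : Reach M n c₁ c₂) :
    (flip bind (TM2.step M))^[n] (some c₁) = some c₂ := by
  induction h with
  | refl => rfl
  | head _ ih => rw [Function.iterate_succ_apply]; exact ih

theorem of_iterate : ∀ {n : ℕ} {c₁ c₂ : TM2.Cfg Γ Λ σ},
    (flip bind (TM2.step M))^[n] (some c₁) = some c₂ → Reach M n c₁ c₂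
  | 0, c₁, c₂, h => by
    cases h; exact refl _
  | n + 1, ⟨none, v, S⟩, c₂, h => by
    rw [Function.iterate_succ_apply] at h
    have : ∀ n : ℕ, (flip bind (TM2.step M))^[n] none = none := fun n => by
      induction n with
      | zero => rfl
      | succ n ih => rw [Function.iterate_succ_apply]; exact ih
    exact absurd (this n ▸ h : none = some c₂) (by simp)
  | n + 1, ⟨some l, v, S⟩, c₂, h => by
    rw [Function.iterate_succ_apply] at h
    exact (of_iterate h).head

end Reach

/-- Rename the labels of a statement by `f`, and replace halting by a jump to `ret`. -/
def relabel (f : Λ → Λ') (ret : Option Λ') : TM2.Stmt Γ Λ σ → TM2.Stmt Γ Λ' σ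
  | .push k g q => .push k g (relabel f ret q)
  | .peek k g q => .peek k g (relabel f ret q)
  | .pop k g q => .pop k g (relabel f ret q)
  | .load g q => .load g (relabel f ret q)
  | .branch g q q' => .branch g (relabel f ret q) (relabel f ret q')
  | .goto g => .goto fun v => f (g v)
  | .halt => match ret with
    | none => .halt
    | some l => .goto fun _ => l

/-- Rename the label of a configuration by `f`, and replace the halting label by `ret`. -/
def relabelCfg (f : Λ → Λ') (ret : Option Λ') (c : TM2.Cfg Γ Λ σ) : TM2.Cfg Γ Λ' σ :=
  ⟨c.l.elim ret fun l => some (f l), c.var, c.stk⟩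

theorem stepAux_relabel (f : Λ → Λ') (ret : Option Λ') (q : TM2.Stmt Γ Λ σ) (v : σ)
    (S : ∀ k, List (Γ k)) :
    TM2.stepAux (relabel f ret q) v S = relabelCfg f ret (TM2.stepAux q v S) := by
  induction q generalizing v S with
  | push k g q ih | peek k g q ih | pop k g q ih | load g q ih => exact ih _ _
  | branch g q q' ih ih' =>
    simp only [relabel, TM2.stepAux]
    cases g v
    · exact ih' _ _
    · exact ih _ _
  | goto g => rfl
  | halt => cases ret <;> rfl

/-- An embedded machine runs step for step as it does alone, and where it would halt, control passes
to `ret` without an extra step. All program combinators rest on this. -/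
theorem Reach.relabel {M : Λ → TM2.Stmt Γ Λ σ} {M' : Λ' → TM2.Stmt Γ Λ' σ} {f : Λ → Λ'}
    {ret : Option Λ'} (hM : ∀ l, M' (f l) = StackProgram.relabel f ret (M l)) {n c c'}
    (h : Reach M n c c') : Reach M' n (relabelCfg f ret c) (relabelCfg f ret c') := by
  induction h with
  | refl => exact .refl _
  | head _ ih =>
    refine .head ?_
    rw [hM, stepAux_relabel]
    exact ih

end Reach

variable (T) in
/-- A program: a machine that is entered at a label and returns control by halting. -/
structure Prog where
  /-- The labels. -/
  Λ : Type
  [fin : Fintype Λ]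
  /-- The label at which the program is entered. -/
  entry : Λ
  /-- The statements. -/
  code : Λ → PStmt T Λ

/-- The internal state when a program is entered and left. -/
abbrev idle : Var T := (none, T.tm.initialState)

/-- Forget the letter that was read last. -/
abbrev reset (v : Var T) : Var T := (none, v.2)

namespace Prog

/-- The program `P` leads from the store `S` to the store `S'` within `N` steps. -/
def Run (P : Prog T) (S S' : Store T) (N : ℕ) : Prop :=
  ∃ n ≤ N, Reach P.code n ⟨some P.entry, idle, S⟩ ⟨none, idle, S'⟩

theorem Run.mono {P : Prog T} {S S' : Store T} {N N' : ℕ} (h : P.Run S S' N) (hN : N ≤ N') :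
    P.Run S S' N' :=
  let ⟨n, hn, hr⟩ := h
  ⟨n, hn.trans hN, hr⟩

/-- Run `P`, then `Q`. -/
def seq (P Q : Prog T) : Prog T where
  Λ := P.Λ ⊕ Q.Λ
  fin := letI := P.fin; letI := Q.fin; inferInstance
  entry := .inl P.entry
  code := Sum.elim (fun l => relabel .inl (some (.inr Q.entry)) (P.code l))
    fun l => relabel .inr none (Q.code l)

theorem Run.seq {P Q : Prog T} {S S' S'' : Store T} {N N' : ℕ} (hP : P.Run S S' N)
    (hQ : Q.Run S' S'' N') : (P.seq Q).Run S S'' (N + N') := by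
  obtain ⟨n, hn, hP⟩ := hP
  obtain ⟨k, hk, hQ⟩ := hQ
  have h₁ := hP.relabel (M' := (P.seq Q).code) (f := .inl) (ret := some (.inr Q.entry))
    fun _ => rfl
  have h₂ := hQ.relabel (M' := (P.seq Q).code) (f := .inr) (ret := none) fun _ => rfl
  exact ⟨n + k, by omega, h₁.trans h₂⟩

/-- The program with the single statement `s`, which may jump back to itself. -/
def single (s : PStmt T Unit) : Prog T where
  Λ := Unit
  entry := ()
  code _ := s

theorem run_single {s : PStmt T Unit} {S S' : Store T}
    (h : TM2.stepAux s idle S = ⟨none, idle, S'⟩) : (single s).Run S S' 1 :=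
  ⟨1, le_rfl, .single h⟩

theorem run_single_of_goto {s : PStmt T Unit} {S S' S'' : Store T} {N : ℕ}
    (h : TM2.stepAux s idle S = ⟨some (), idle, S'⟩) (h' : (single s).Run S' S'' N) :
    (single s).Run S S'' (N + 1) :=
  let ⟨n, hn, hr⟩ := h'
  ⟨n + 1, by omega, .head (h ▸ hr)⟩

/-- Run `P` or `Q`, depending on the top of the main stack. -/
def ite (p : Option Letter → Bool) (P Q : Prog T) : Prog T where
  Λ := Option (P.Λ ⊕ Q.Λ)
  fin := letI := P.fin; letI := Q.fin; inferInstance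
  entry := none
  code l := l.elim
    (.peek (.inl .a) (fun v x => (x, v.2)) <| .branch (fun v => p v.1)
      (.load reset <| .goto fun _ => some (.inl P.entry))
      (.load reset <| .goto fun _ => some (.inr Q.entry)))
    (Sum.elim (fun l => relabel (fun l => some (.inl l)) none (P.code l))
      fun l => relabel (fun l => some (.inr l)) none (Q.code l))

theorem run_ite {p : Option Letter → Bool} {P Q : Prog T} {S S' : Store T} {N : ℕ}
    (h : (bif p (S (.inl .a)).head? then P else Q).Run S S' N) : (ite p P Q).Run S S' (N + 1) := by
  cases hp : p (S (.inl .a)).head? <;> rw [hp] at h <;> obtain ⟨n, hn, hr⟩ := h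
  · have := hr.relabel (M' := (ite p P Q).code) (f := fun l => some (.inr l)) (ret := none)
      fun _ => rfl
    exact ⟨n + 1, by omega, .cons (by simp [ite, hp, relabelCfg]) this⟩
  · have := hr.relabel (M' := (ite p P Q).code) (f := fun l => some (.inl l)) (ret := none)
      fun _ => rfl
    exact ⟨n + 1, by omega, .cons (by simp [ite, hp, relabelCfg]) this⟩

/-- With the code of a tree `(x, y)` on top of the main stack: as long as `x` is not the leaf
`none`, run `P`; at the end, leave `y`. -/
def loop (P : Prog T) : Prog T where
  Λ := Option P.Λ
  fin := letI := P.fin; inferInstance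
  entry := none
  code l := l.elim
    -- The letter of the root covers the first letter of `x`, so it is popped for the test and put
    -- back before the body runs.
    (.pop (.inl .a) (fun v _ => v) <| .peek (.inl .a) (fun v x => (x, v.2)) <|
      .branch (fun v => v.1 = some (some none))
        (.pop (.inl .a) (fun v _ => reset v) .halt)
        (.push (.inl .a) (fun _ => none) <| .load reset <| .goto fun _ => some P.entry))
    fun l => relabel some (some none) (P.code l)

theorem run_loop_exit (P : Prog T) (io : List Label) (A b c : List Letter) (d : List Unit)
    (R : ∀ k, List (T.tm.Γ k)) :
    (loop P).Run (stk io (none :: some none :: A) b c d R) (stk io A b c d R) 1 :=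
  ⟨1, le_rfl, .single (by simp [loop])⟩

theorem run_loop_body {P : Prog T} {io : List Label} {A b c : List Letter} {d : List Unit}
    {R : ∀ k, List (T.tm.Γ k)} {S' S'' : Store T} {N N' : ℕ} (hA : A.head? ≠ some (some none))
    (h : P.Run (stk io (none :: A) b c d R) S' N) (h' : (loop P).Run S' S'' N') :
    (loop P).Run (stk io (none :: A) b c d R) S'' (N + N' + 1) := by
  obtain ⟨n, hn, hr⟩ := h
  obtain ⟨n', hn', hr'⟩ := h'
  have := hr.relabel (M' := (loop P).code) (f := some) (ret := some none) fun _ => rfl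
  exact ⟨n + n' + 1, by omega, .cons (by simp [loop, hA, relabelCfg]) (this.trans hr')⟩

end Prog

end StackProgram

/-! ### Moving, copying and creating tree codes on the main stack. -/

namespace StackProgram

open Turing Voting

/-! ### Trees and their codes -/

/-- Binary trees with labelled leaves. -/
inductive LTree : Type
  | leaf (x : Label)
  | node (x y : LTree)

namespace LTree

/-- The prefix code of a tree. -/
def code : LTree → List Letter
  | leaf x => [some x]
  | node x y => none :: (code x ++ code y)

/-- The number of nodes of a tree. -/
def size : LTree → ℕ
  | leaf _ => 1
  | node x y => size x + size y + 1

@[simp] theorem length_code (t : LTree) : t.code.length = t.size := by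
  induction t with
  | leaf x => rfl
  | node x y hx hy => simp [code, size, hx, hy]

theorem size_pos (t : LTree) : 0 < t.size := by
  cases t <;> simp [size]

end LTree

open LTree (leaf node)

variable {T : TM2ComputableAux Sym Sym}

namespace Prog

/-- Do nothing. -/
def skip : Prog T := single .halt

theorem run_skip (S : Store T) : (skip : Prog T).Run S S 1 := run_single rfl

/-- Push a letter on the main stack. -/
def push (x : Letter) : Prog T := single (.push (.inl .a) (fun _ => x) .halt)

theorem run_push (x : Letter) (io : List Label) (A b c : List Letter) (d : List Unit)
    (R : ∀ k, List (T.tm.Γ k)) :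
    (push x).Run (stk io A b c d R) (stk io (x :: A) b c d R) 1 :=
  run_single (by simp)

/-- Pop a letter from the main stack. -/
def pop : Prog T := single (.pop (.inl .a) (fun v _ => v) .halt)

theorem run_pop (x : Letter) (io : List Label) (A b c : List Letter) (d : List Unit)
    (R : ∀ k, List (T.tm.Γ k)) :
    pop.Run (stk io (x :: A) b c d R) (stk io A b c d R) 1 :=
  run_single (by simp)

/-- Push a letter on the stack `b` or `c`, if `p` is true. -/
def pushIf (p : Bool) (k : Base) (f : Var T → Alph T (.inl k)) (q : PStmt T Unit) : PStmt T Unit :=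
  bif p then .push (.inl k) f q else q

/-- Pop trees from the main stack, as many as `d` tells. If `p` is true, their letters go to `b`,
if `q` is true, they go to `c`. -/
def takeTrees (p q : Bool) : Prog T := single <|
  .pop (.inl .d) (fun v x => (x.map fun _ => none, v.2)) <|
  .branch (fun v => v.1 = none) .halt <|
  .pop (.inl .a) (fun v x => (x, v.2)) <|
  pushIf p .b (fun v => v.1.getD none) <|
  pushIf q .c (fun v => v.1.getD none) <|
  .branch (fun v => v.1 = some none)
    (.push (.inl .d) (fun _ => ()) <| .push (.inl .d) (fun _ => ()) <| .load reset <|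
      .goto fun _ => ())
    (.load reset <| .goto fun _ => ())

/-- A prefix code needs no end marker if `d` counts the trees still to be read: a leaf uses up one,
an inner node replaces one by two. Stating this relative to the run `h` that follows `t` makes the
induction on `t` go through. -/
theorem run_takeTrees_step (p q : Bool) (t : LTree) {io : List Label} {A b c : List Letter}
    {d : List Unit} {R : ∀ k, List (T.tm.Γ k)} {S : Store T} {N : ℕ}
    (h : (takeTrees p q).Run (stk io A (bif p then t.code.reverse ++ b else b)
      (bif q then t.code.reverse ++ c else c) d R) S N) :
    (takeTrees p q).Run (stk io (t.code ++ A) b c (() :: d) R) S (N + t.size) := by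
  induction t generalizing A b c d N with
  | leaf x =>
    refine run_single_of_goto ?_ h
    cases p <;> cases q <;> simp [pushIf, LTree.code]
  | node x y hx hy =>
    have h₁ := @hx (y.code ++ A) (bif p then none :: b else b) (bif q then none :: c else c)
      (() :: d) (N + y.size) (by
        refine hy ?_
        convert h using 2
        · cases p <;> simp [LTree.code]
        · cases q <;> simp [LTree.code])
    refine (run_single_of_goto ?_ h₁).mono (by simp only [LTree.size]; omega)
    cases p <;> cases q <;> simp [pushIf, LTree.code]

/-- Pop a tree from the main stack. If `p` is true, its letters go to `b`, if `q` is true, they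
go to `c`. -/
def takeTree (p q : Bool) : Prog T :=
  (single (.push (.inl .d) (fun _ => ()) .halt)).seq (takeTrees p q)

theorem run_takeTree (p q : Bool) (t : LTree) (io : List Label) (A b c : List Letter)
    (R : ∀ k, List (T.tm.Γ k)) :
    (takeTree p q).Run (stk io (t.code ++ A) b c [] R)
      (stk io A (bif p then t.code.reverse ++ b else b) (bif q then t.code.reverse ++ c else c)
        [] R) (t.size + 2) := by
  have h₁ : (single (.push (.inl .d) (fun _ => ()) .halt)).Run (stk io (t.code ++ A) b c [] R)
    (stk io (t.code ++ A) b c [()] R) 1 := run_single (by simp)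
  have h₂ : (takeTrees p q).Run (stk io A (bif p then t.code.reverse ++ b else b)
    (bif q then t.code.reverse ++ c else c) [] R) _ 1 := run_single (by simp; rfl)
  exact (h₁.seq (run_takeTrees_step p q t h₂)).mono (by omega)

/-- Move all letters of the stack `b` to the main stack. -/
def flushB : Prog T := single <|
  .pop (.inl .b) (fun v x => (x, v.2)) <| .branch (fun v => v.1 = none) .halt <|
  .push (.inl .a) (fun v => v.1.getD none) <| .load reset <| .goto fun _ => ()

theorem run_flushB (io : List Label) (A b c : List Letter) (d : List Unit)
    (R : ∀ k, List (T.tm.Γ k)) :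
    flushB.Run (stk io A b c d R) (stk io (b.reverse ++ A) [] c d R) (b.length + 1) := by
  induction b generalizing A with
  | nil => exact run_single (by simp)
  | cons x b ih =>
    exact run_single_of_goto (S' := stk io (x :: A) b c d R) (by simp)
      (by simpa [flushB] using ih (x :: A))

/-- Move all letters of the stack `c` to the main stack. -/
def flushC : Prog T := single <|
  .pop (.inl .c) (fun v x => (x, v.2)) <| .branch (fun v => v.1 = none) .halt <|
  .push (.inl .a) (fun v => v.1.getD none) <| .load reset <| .goto fun _ => ()

theorem run_flushC (io : List Label) (A b c : List Letter) (d : List Unit)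
    (R : ∀ k, List (T.tm.Γ k)) :
    flushC.Run (stk io A b c d R) (stk io (c.reverse ++ A) b [] d R) (c.length + 1) := by
  induction c generalizing A with
  | nil => exact run_single (by simp)
  | cons x c ih =>
    exact run_single_of_goto (S' := stk io (x :: A) b c d R) (by simp)
      (by simpa [flushC] using ih (x :: A))

/-- Remove the tree on top of the main stack. -/
def drop : Prog T := takeTree false false

theorem run_drop (t : LTree) (A : List Letter) :
    (drop : Prog T).Run (main (t.code ++ A)) (main A) (t.size + 2) :=
  run_takeTree false false t [] A [] [] fun _ => []

/-- Duplicate the tree on top of the main stack. -/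
def dup : Prog T := (takeTree true true).seq (flushB.seq flushC)

theorem run_dup (t : LTree) (A : List Letter) :
    (dup : Prog T).Run (main (t.code ++ A)) (main (t.code ++ (t.code ++ A))) (3 * t.size + 4) := by
  have h := (run_takeTree (T := T) true true t [] A [] [] fun _ => []).seq
    ((run_flushB _ _ _ _ _ _).seq (run_flushC _ _ _ _ _ _))
  simp only [cond_true, List.append_nil, List.reverse_reverse, List.length_reverse,
    LTree.length_code] at h
  exact h.mono (by omega)

/-- Swap the two topmost trees of the main stack. -/
def swap : Prog T := (takeTree true false).seq ((takeTree false true).seq (flushB.seq flushC))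

theorem run_swap (s t : LTree) (A : List Letter) :
    (swap : Prog T).Run (main (s.code ++ (t.code ++ A))) (main (t.code ++ (s.code ++ A)))
      (2 * s.size + 2 * t.size + 6) := by
  have h := (run_takeTree (T := T) true false s [] (t.code ++ A) [] [] fun _ => []).seq
    ((run_takeTree false true t _ _ _ _ _).seq
      ((run_flushB _ _ _ _ _ _).seq (run_flushC _ _ _ _ _ _)))
  simp only [cond_true, cond_false, List.append_nil, List.reverse_reverse, List.length_reverse,
    LTree.length_code] at h
  exact h.mono (by omega)

/-- Put a fixed tree on the main stack. -/
def pushTree : LTree → Prog T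
  | leaf x => push (some x)
  | node x y => (pushTree y).seq ((pushTree x).seq (push none))

theorem run_pushTree (t : LTree) (A : List Letter) :
    (pushTree t : Prog T).Run (main A) (main (t.code ++ A)) t.size := by
  induction t generalizing A with
  | leaf x => exact run_push _ _ _ _ _ _ _
  | node x y hx hy =>
    have h := (hy A).seq ((hx (y.code ++ A)).seq (run_push none _ _ _ _ _ _))
    simp only [LTree.code, List.cons_append, List.append_assoc]
    exact h.mono (by simp only [LTree.size]; omega)

end Prog

end StackProgram

/-! ### Polynomial-time functions on tree codes and their basic closure properties. -/

namespace StackProgram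

open Turing Voting
open LTree (leaf node)

theorem eval_mono (p : Polynomial ℕ) {a b : ℕ} (h : a ≤ b) : p.eval a ≤ p.eval b := by
  rw [Polynomial.eval_eq_sum_range, Polynomial.eval_eq_sum_range]
  gcongr

/-! ### Encodings as trees -/

/-- Types whose elements are encoded as trees. -/
class Enc (X : Type) where
  /-- The tree that encodes an element. -/
  enc : X → LTree

open Enc (enc)

/-- The size of the encoding of an element. -/
def esize {X : Type} [Enc X] (x : X) : ℕ := (enc x).size

section instances

variable {X Y : Type} [Enc X] [Enc Y]

instance : Enc Label := ⟨leaf⟩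

instance : Enc Unit := ⟨fun _ => leaf none⟩

instance : Enc Bool := ⟨fun b => leaf (bif b then some .tick else none)⟩

instance : Enc (X × Y) := ⟨fun x => node (enc x.1) (enc x.2)⟩

/-- A nonempty list has the same tree as the pair of its head and tail, so list operations reduce to
pair operations and a test of the root. -/
instance : Enc (List X) := ⟨fun l => l.foldr (fun x t => node (enc x) t) (leaf none)⟩

instance : Enc ℕ := ⟨fun n => enc (List.replicate n ())⟩

theorem enc_bool (b : Bool) : enc b = leaf (bif b then some .tick else none) := rfl

theorem enc_unit (x : Unit) : enc x = leaf none := rfl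

theorem enc_label (x : Label) : enc x = leaf x := rfl

theorem enc_prod (x : X × Y) : enc x = node (enc x.1) (enc x.2) := rfl

theorem enc_nil : enc ([] : List X) = leaf none := rfl

theorem enc_cons (x : X) (l : List X) : enc (x :: l) = node (enc x) (enc l) := rfl

theorem enc_nat (n : ℕ) : enc n = enc (List.replicate n ()) := rfl

theorem esize_pos (x : X) : 0 < esize x := LTree.size_pos _

theorem esize_prod (x : X) (y : Y) : esize (x, y) = esize x + esize y + 1 := rfl

theorem esize_prod' (x : X × Y) : esize x = esize x.1 + esize x.2 + 1 := rfl

@[simp] theorem esize_bool (b : Bool) : esize b = 1 := rfl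

@[simp] theorem esize_label (x : Label) : esize x = 1 := rfl

@[simp] theorem esize_unit (x : Unit) : esize x = 1 := rfl

@[simp] theorem esize_nil : esize ([] : List X) = 1 := rfl

@[simp] theorem esize_cons (x : X) (l : List X) : esize (x :: l) = esize x + esize l + 1 := rfl

theorem esize_append (l l' : List X) : esize (l ++ l') + 1 = esize l + esize l' := by
  induction l with
  | nil => simp [add_comm]
  | cons x l ih => simp only [List.cons_append, esize_cons]; omega

theorem esize_le_of_mem {x : X} {l : List X} (h : x ∈ l) : esize x ≤ esize l := by
  induction l with
  | nil => simp at h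
  | cons y l ih =>
    rcases List.mem_cons.1 h with rfl | h
    · simp only [esize_cons]; omega
    · have := ih h; simp only [esize_cons]; omega

theorem length_lt_esize (l : List X) : l.length < esize l := by
  induction l with
  | nil => simp
  | cons y l ih => simp only [esize_cons, List.length_cons]; omega

@[simp] theorem esize_nat (n : ℕ) : esize n = 2 * n + 1 := by
  have : ∀ n, esize (List.replicate n ()) = 2 * n + 1 := fun n => by
    induction n with
    | zero => rfl
    | succ n ih => rw [List.replicate_succ, esize_cons, ih]; simp; ring
  exact this n

theorem esize_labels (l : List Label) : esize l = 2 * l.length + 1 := by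
  induction l with
  | nil => rfl
  | cons x l ih => simp only [esize_cons, ih, esize_label, List.length_cons]; ring

end instances

/-! ### Functions computable in polynomial time -/

variable (T : TM2ComputableAux Sym Sym)

/-- Some program with oracle machine `T` computes `f` on the main stack in polynomial time. -/
def PolyTime {X Y : Type} [Enc X] [Enc Y] (f : X → Y) : Prop :=
  -- The output size is bounded along with the time because in a composition the next program is
  -- timed by the size of its input.
  ∃ (P : Prog T) (p : Polynomial ℕ), ∀ x, esize (f x) ≤ p.eval (esize x) ∧
    ∀ A, P.Run (main ((enc x).code ++ A)) (main ((enc (f x)).code ++ A)) (p.eval (esize x))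

variable {T}

namespace PolyTime

open Prog

variable {X Y Z W : Type} [Enc X] [Enc Y] [Enc Z] [Enc W]

theorem esize_le {f : X → Y} (hf : PolyTime T f) :
    ∃ p : Polynomial ℕ, ∀ x, esize (f x) ≤ p.eval (esize x) :=
  let ⟨_, p, h⟩ := hf
  ⟨p, fun x => (h x).1⟩

/-- Covers mere changes of reading, such as a pair as a nonempty list or a number as a list of
units. -/
theorem of_enc_eq {f : X → Y} (h : ∀ x, enc (f x) = enc x) : PolyTime T f :=
  ⟨skip, Polynomial.X + 1, fun x => by
    refine ⟨by simp [esize, h], fun A => ?_⟩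
    rw [h]
    exact (run_skip _).mono (by simp)⟩

protected theorem id : PolyTime T fun x : X => x := of_enc_eq fun _ => rfl

theorem comp {g : Y → Z} {f : X → Y} (hg : PolyTime T g) (hf : PolyTime T f) :
    PolyTime T fun x => g (f x) := by
  obtain ⟨P, p, hp⟩ := hf
  obtain ⟨Q, q, hq⟩ := hg
  refine ⟨P.seq Q, p + q.comp p, fun x => ⟨?_, fun A => ?_⟩⟩
  · have := (hq (f x)).1.trans (eval_mono q (hp x).1)
    simp only [Polynomial.eval_add, Polynomial.eval_comp]
    omega
  · refine (((hp x).2 A).seq ((hq (f x)).2 A)).mono ?_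
    have := eval_mono q (hp x).1
    simp only [Polynomial.eval_add, Polynomial.eval_comp]
    omega

theorem const (y : Y) : PolyTime T fun _ : X => y :=
  ⟨drop.seq (pushTree (enc y)), Polynomial.X + 2 + Polynomial.C (esize y), fun x => by
    simp only [Polynomial.eval_add, Polynomial.eval_X, Polynomial.eval_C, Polynomial.eval_ofNat]
    exact ⟨by omega, fun A => (run_drop _ A).seq (run_pushTree _ A)⟩⟩

theorem pair {f : X → Y} {g : X → Z} (hf : PolyTime T f) (hg : PolyTime T g) :
    PolyTime T fun x => (f x, g x) := by
  obtain ⟨P, p, hp⟩ := hf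
  obtain ⟨Q, q, hq⟩ := hg
  refine ⟨dup.seq (P.seq (swap.seq (Q.seq (swap.seq (push none))))),
    5 * Polynomial.X + 5 * p + 5 * q + 20, fun x => ⟨?_, fun A => ?_⟩⟩
  · have h₁ := (hp x).1
    have h₂ := (hq x).1
    simp only [esize_prod, Polynomial.eval_add, Polynomial.eval_mul, Polynomial.eval_X,
      Polynomial.eval_ofNat]
    omega
  · have h₁ := (hp x).1
    have h₂ := (hq x).1
    have h := (run_dup _ A).seq (((hp x).2 _).seq ((run_swap _ _ A).seq (((hq x).2 _).seq
      ((run_swap _ _ A).seq (run_push none _ _ _ _ _ _)))))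
    have e : (enc (f x, g x)).code ++ A = none :: ((enc (f x)).code ++ ((enc (g x)).code ++ A)) := by
      simp [enc_prod, LTree.code]
    rw [e]
    refine h.mono ?_
    simp only [Polynomial.eval_add, Polynomial.eval_mul, Polynomial.eval_X,
      Polynomial.eval_ofNat]
    change _ + (_ + ((2 * esize (f x) + 2 * esize x + 6) + (_ +
      ((2 * esize (g x) + 2 * esize (f x) + 6) + 1)))) ≤ _
    change 3 * esize x + 4 + _ ≤ _
    omega

/-- Functions computed by a case distinction on the root of the encoding. -/
theorem of_ite {f : X → Y} (t : Option Letter → Bool) {P Q : Prog T} (p : Polynomial ℕ)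
    (hP : ∀ x, t (enc x).code.head? = true → esize (f x) ≤ p.eval (esize x) ∧ ∀ A,
      P.Run (main ((enc x).code ++ A)) (main ((enc (f x)).code ++ A)) (p.eval (esize x)))
    (hQ : ∀ x, t (enc x).code.head? = false → esize (f x) ≤ p.eval (esize x) ∧ ∀ A,
      Q.Run (main ((enc x).code ++ A)) (main ((enc (f x)).code ++ A)) (p.eval (esize x))) :
    PolyTime T f := by
  refine ⟨ite t P Q, p + 1, fun x => ?_⟩
  have hh : ∀ A, ((enc x).code ++ A).head? = (enc x).code.head? := fun A => by
    cases enc x <;> rfl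
  simp only [Polynomial.eval_add, Polynomial.eval_one]
  cases hx : t (enc x).code.head?
  · refine ⟨(hQ x hx).1.trans (Nat.le_succ _), fun A => run_ite ?_⟩
    change (bif t ((enc x).code ++ A).head? then P else Q).Run _ _ _
    rw [hh, hx]
    exact (hQ x hx).2 A
  · refine ⟨(hP x hx).1.trans (Nat.le_succ _), fun A => run_ite ?_⟩
    change (bif t ((enc x).code ++ A).head? then P else Q).Run _ _ _
    rw [hh, hx]
    exact (hP x hx).2 A

theorem of_eq_leaf {f : X → Bool} (l : Label) (h : ∀ x, f x = true ↔ enc x = leaf l) :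
    PolyTime T f := by
  have hl : ∀ x, f x = decide ((enc x).code.head? = some (some l)) := fun x => by
    rw [Bool.eq_iff_iff, h, decide_eq_true_iff]
    cases enc x <;> simp [LTree.code]
  refine of_ite (fun y => y = some (some l)) (P := drop.seq (pushTree (enc true)))
    (Q := drop.seq (pushTree (enc false))) (Polynomial.X + 3) (fun x hx => ?_) fun x hx => ?_
  all_goals
    have hx' := (hl x).trans hx
    simp only [Polynomial.eval_add, Polynomial.eval_X, Polynomial.eval_ofNat, esize_bool]
    refine ⟨by omega, fun A => ?_⟩
    rw [hx']
    exact (run_drop _ A).seq (run_pushTree _ A)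

theorem fst : PolyTime T fun x : X × Y => x.1 :=
  ⟨pop.seq (swap.seq drop), 4 * Polynomial.X + 10, fun x => by
    have h := fun A => (run_pop none _ _ _ _ _ _).seq ((run_swap (enc x.1) (enc x.2) A).seq
      (run_drop (T := T) _ _))
    simp only [← esize.eq_def] at h
    simp only [Polynomial.eval_add, Polynomial.eval_mul, Polynomial.eval_X,
      Polynomial.eval_ofNat, esize_prod']
    refine ⟨by omega, fun A => ?_⟩
    have e : (enc x).code ++ A = none :: ((enc x.1).code ++ ((enc x.2).code ++ A)) := by
      simp [enc_prod, LTree.code]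
    rw [e]
    refine (h A).mono ?_
    simp only [esize]
    omega⟩

theorem run_snd (x y : LTree) (A : List Letter) :
    (pop.seq drop : Prog T).Run (main ((node x y).code ++ A)) (main (y.code ++ A)) (x.size + 3) := by
  have e : (node x y).code ++ A = none :: (x.code ++ (y.code ++ A)) := by
    simp [LTree.code]
  rw [e]
  exact ((run_pop _ _ _ _ _ _ _).seq (run_drop _ _)).mono (by omega)

theorem snd : PolyTime T fun x : X × Y => x.2 :=
  ⟨pop.seq drop, Polynomial.X + 3, fun x => by
    simp only [Polynomial.eval_add, Polynomial.eval_X, Polynomial.eval_ofNat, esize_prod']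
    exact ⟨by omega, fun A => (run_snd _ _ A).mono (by simp only [esize]; omega)⟩⟩

theorem tail : PolyTime T fun l : List X => l.tail := by
  refine of_ite (fun y => y = some none) (P := pop.seq drop) (Q := skip) (Polynomial.X + 3)
    (fun l hl => ?_) fun l hl => ?_
  all_goals
    simp only [Polynomial.eval_add, Polynomial.eval_X, Polynomial.eval_ofNat]
    cases l with
    | nil => first
      | simp [enc_nil, LTree.code] at hl; done
      | exact ⟨by simp, fun A => (run_skip _).mono (by omega)⟩
    | cons x l => first
      | simp [enc_cons, LTree.code] at hl; done
      | exact ⟨by simp; omega, fun A =>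
          (run_snd _ _ A).mono (by simp only [esize_cons]; simp only [esize]; omega)⟩

/-- A function defined by cases on a Boolean. -/
theorem cond {c : X → Bool} {f g : X → Y} (hc : PolyTime T c) (hf : PolyTime T f)
    (hg : PolyTime T g) : PolyTime T fun x => bif c x then f x else g x := by
  obtain ⟨P, p, hp⟩ := hf
  obtain ⟨Q, q, hq⟩ := hg
  have key : PolyTime T fun y : Bool × X => bif y.1 then f y.2 else g y.2 := by
    refine ⟨pop.seq (ite (fun y => y = some (some none)) (drop.seq Q) (drop.seq P)),
      p + q + 5, fun y => ?_⟩
    obtain ⟨b, x⟩ := y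
    have h₁ := (hp x).1
    have h₂ := (hq x).1
    have e : ∀ A, (enc (b, x)).code ++ A = none :: ((enc b).code ++ ((enc x).code ++ A)) :=
      fun A => by simp [enc_prod, LTree.code]
    have m₁ := eval_mono p (show esize x ≤ esize (b, x) by rw [esize_prod]; omega)
    have m₂ := eval_mono q (show esize x ≤ esize (b, x) by rw [esize_prod]; omega)
    simp only [Polynomial.eval_add, Polynomial.eval_ofNat, e]
    refine ⟨by cases b <;> simp only [cond_true, cond_false] <;> omega, fun A => ?_⟩
    cases b
    · refine ((run_pop none _ _ _ _ _ _).seq (run_ite (P := drop.seq Q) (Q := drop.seq P)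
        (S' := main ((enc (g x)).code ++ A))
        (N := (enc false).size + 2 + q.eval (esize x)) ?_)).mono ?_
      · simpa [enc_bool, LTree.code] using (run_drop (enc false) _).seq ((hq x).2 A)
      · simp only [enc_bool, LTree.size]; omega
    · refine ((run_pop none _ _ _ _ _ _).seq (run_ite (P := drop.seq Q) (Q := drop.seq P)
        (S' := main ((enc (f x)).code ++ A))
        (N := (enc true).size + 2 + p.eval (esize x)) ?_)).mono ?_
      · simpa [enc_bool, LTree.code] using (run_drop (enc true) _).seq ((hp x).2 A)
      · simp only [enc_bool, LTree.size]; omega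
  exact key.comp (hc.pair .id)

theorem cons' : PolyTime T fun x : X × List X => x.1 :: x.2 := of_enc_eq fun _ => rfl

theorem cons {f : X → Y} {g : X → List Y} (hf : PolyTime T f) (hg : PolyTime T g) :
    PolyTime T fun x => f x :: g x :=
  cons'.comp (hf.pair hg)

theorem isEmpty {f : X → List Y} (hf : PolyTime T f) : PolyTime T fun x => (f x).isEmpty :=
  (of_eq_leaf (f := fun l : List Y => l.isEmpty) none fun l => by
    cases l <;> simp [enc_nil, enc_cons]).comp hf

theorem headD {f : X → List Y} (hf : PolyTime T f) (d : Y) :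
    PolyTime T fun x => (f x).headD d := by
  refine PolyTime.comp (g := fun l : List Y => l.headD d) ?_ hf
  obtain ⟨P, p, hp⟩ := PolyTime.fst (T := T) (X := Y) (Y := List Y)
  obtain ⟨Q, q, hq⟩ := PolyTime.const (T := T) (X := List Y) d
  refine of_ite (fun y => y = some none) (P := P) (Q := Q) (p + q) (fun l hl => ?_) fun l hl => ?_
  all_goals
    simp only [Polynomial.eval_add]
    cases l with
    | nil => first
      | simp [enc_nil, LTree.code] at hl; done
      | exact ⟨(hq []).1.trans (by omega), fun A => ((hq []).2 A).mono (by omega)⟩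
    | cons x l => first
      | simp [enc_cons, LTree.code] at hl; done
      | exact ⟨(hp (x, l)).1.trans (Nat.le_add_right _ _), fun A =>
          ((hp (x, l)).2 A).mono (Nat.le_add_right _ _)⟩

/-! ### Folds -/

/-- The loop state holds the unread elements, the context `x` and the accumulator; the list comes
first so that `loop` stops when it is empty. As `N` bounds all intermediate states, every pass costs
at most `p.eval N + 1`. -/
theorem run_loop_foldl {h : X × Y × Z → Y} {P : Prog T} {p : Polynomial ℕ} {x : X}
    (hP : ∀ (z : Z) (l : List Z) (b : Y) (A : List Letter),
      P.Run (main ((enc (z :: l, x, b)).code ++ A)) (main ((enc (l, x, h (x, b, z))).code ++ A))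
        (p.eval (esize (z :: l, x, b)))) (N : ℕ) (l : List Z) (b : Y)
    (hN : ∀ l₁ l₂, l = l₁ ++ l₂ → esize (l₂, x, l₁.foldl (fun b z => h (x, b, z)) b) ≤ N)
    (A : List Letter) :
    (loop P).Run (main ((enc (l, x, b)).code ++ A))
      (main ((enc (x, l.foldl (fun b z => h (x, b, z)) b)).code ++ A))
      (l.length * (p.eval N + 1) + 1) := by
  induction l generalizing b with
  | nil =>
    have := run_loop_exit P [] ((enc (x, b)).code ++ A) [] [] [] fun _ => []
    simpa [enc_prod (X := List Z), enc_nil, LTree.code] using this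
  | cons z l ih =>
    have h₁ := ih (h (x, b, z)) fun l₁ l₂ hl => hN (z :: l₁) l₂ (by simp [hl])
    have h₂ := (hP z l b A).mono (eval_mono p (hN [] _ rfl))
    have e : (enc (z :: l, x, b)).code ++ A =
        none :: ((enc (z :: l)).code ++ ((enc (x, b)).code ++ A)) := by
      simp [enc_prod (X := List Z), LTree.code]
    rw [e] at h₂ ⊢
    refine (run_loop_body ?_ h₂ h₁).mono ?_
    · simp [enc_cons, LTree.code]
    · simp only [List.length_cons]
      ring_nf
      omega

/-- Folds with intermediate results of polynomial size. -/
theorem foldl {f : X → List Z} {g : X → Y} {h : X × Y × Z → Y} (hf : PolyTime T f)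
    (hg : PolyTime T g) (hh : PolyTime T h) (r : Polynomial ℕ)
    -- Without such a bound, a polynomial-time step that doubles the accumulator would lead to
    -- exponential size.
    (hr : ∀ x l, l <+: f x → esize (l.foldl (fun b z => h (x, b, z)) (g x)) ≤ r.eval (esize x)) :
    PolyTime T fun x => (f x).foldl (fun b z => h (x, b, z)) (g x) := by
  obtain ⟨F, pf, hF⟩ := hf.pair (PolyTime.id.pair hg)
  obtain ⟨S, ps, hS⟩ := PolyTime.snd (T := T) (X := X) (Y := Y)
  have body : PolyTime T fun y : (Z × List Z) × X × Y => (y.1.2, y.2.1, h (y.2.1, y.2.2, y.1.1)) :=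
    (snd.comp fst).pair ((fst.comp snd).pair (hh.comp
      ((fst.comp snd).pair ((snd.comp snd).pair (fst.comp fst)))))
  obtain ⟨P, p, hP⟩ := body
  -- Unread list, context and accumulator, plus the two nodes that join them.
  let N : Polynomial ℕ := pf + Polynomial.X + r + 2
  refine ⟨F.seq ((loop P).seq S), pf + pf * (p.comp N + 1) + 1 + ps.comp N + r, fun x => ?_⟩
  have hlen : ∀ l₂, l₂ <:+ f x → esize l₂ ≤ pf.eval (esize x) := fun l₂ hl => by
    obtain ⟨l₁, hl⟩ := hl
    have h₁ := (hF x).1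
    have h₂ := esize_append l₁ l₂
    have h₃ := esize_pos l₁
    rw [esize_prod, ← hl] at h₁
    omega
  have hN : ∀ l₁ l₂, f x = l₁ ++ l₂ →
      esize (l₂, x, l₁.foldl (fun b z => h (x, b, z)) (g x)) ≤ N.eval (esize x) :=
    fun l₁ l₂ hl => by
      have h₁ := hlen l₂ ⟨l₁, hl.symm⟩
      have h₂ := hr x l₁ ⟨l₂, hl.symm⟩
      simp only [esize_prod, N, Polynomial.eval_add, Polynomial.eval_X, Polynomial.eval_ofNat]
      omega
  have hx := hr x (f x) List.prefix_rfl
  simp only [Polynomial.eval_add, Polynomial.eval_mul, Polynomial.eval_one, Polynomial.eval_comp]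
  refine ⟨hx.trans (by omega), fun A => ?_⟩
  have h₁ := run_loop_foldl (h := h) (x := x) (fun z l b A => (hP ((z, l), x, b)).2 A)
    (N.eval (esize x)) (f x) (g x) hN A
  have h₂ := (hS (x, (f x).foldl (fun b z => h (x, b, z)) (g x))).2 A
  refine (((hF x).2 A).seq (h₁.seq h₂)).mono ?_
  have h₃ : (f x).length ≤ pf.eval (esize x) :=
    (length_lt_esize _).le.trans (hlen _ List.suffix_rfl)
  have h₄ := Nat.mul_le_mul_right (p.eval (N.eval (esize x)) + 1) h₃
  have h₅ := eval_mono ps (show esize (x, (f x).foldl (fun b z => h (x, b, z)) (g x)) ≤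
    N.eval (esize x) by have := hN (f x) [] (by simp); rw [esize_prod] at this; omega)
  omega

/-- Folds in which each step increases the size at most by a polynomial. -/
theorem foldl_of_add {f : X → List Z} {g : X → Y} {h : X × Y × Z → Y} (hf : PolyTime T f)
    (hg : PolyTime T g) (hh : PolyTime T h) (r : Polynomial ℕ)
    (hr : ∀ x b z, z ∈ f x → esize (h (x, b, z)) ≤ esize b + r.eval (esize x)) :
    PolyTime T fun x => (f x).foldl (fun b z => h (x, b, z)) (g x) := by
  obtain ⟨pf, hpf⟩ := hf.esize_le
  obtain ⟨pg, hpg⟩ := hg.esize_le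
  refine foldl hf hg hh (pg + pf * r) fun x l hl => ?_
  have key : ∀ (l : List Z), (∀ z ∈ l, z ∈ f x) → ∀ b,
      esize (l.foldl (fun b z => h (x, b, z)) b) ≤ esize b + l.length * r.eval (esize x) := by
    intro l
    induction l with
    | nil => simp
    | cons z l ih =>
      intro hl b
      have h₁ := ih (fun z hz => hl z (by simp [hz])) (h (x, b, z))
      have h₂ := hr x b z (hl z (by simp))
      rw [List.foldl_cons, List.length_cons, Nat.succ_mul]
      omega
  have h₁ := key l (fun z hz => hl.subset hz) (g x)
  have h₂ : l.length ≤ pf.eval (esize x) :=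
    hl.length_le.trans ((length_lt_esize _).le.trans (hpf x))
  have h₃ := Nat.mul_le_mul_right (r.eval (esize x)) h₂
  have h₄ := hpg x
  simp only [Polynomial.eval_add, Polynomial.eval_mul]
  omega

end PolyTime

end StackProgram

/-! ### Interfaces to the oracle machine and to the tapes of Turing machines. -/

namespace StackProgram

open Turing Voting
open LTree (leaf node)

/-! ### Calls of the oracle machine -/

section Oracle

variable {T : TM2ComputableAux Sym Sym}

/-- A statement of the oracle machine as a statement of a program. -/
def liftStmt : TM2.Stmt T.tm.Γ T.tm.Λ T.tm.σ → PStmt T T.tm.Λ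
  | .push k f q => .push (.inr k) (fun v => f v.2) (liftStmt q)
  | .peek k f q => .peek (.inr k) (fun v x => (v.1, f v.2 x)) (liftStmt q)
  | .pop k f q => .pop (.inr k) (fun v x => (v.1, f v.2 x)) (liftStmt q)
  | .load f q => .load (fun v => (v.1, f v.2)) (liftStmt q)
  | .branch f q q' => .branch (fun v => f v.2) (liftStmt q) (liftStmt q')
  | .goto f => .goto fun v => f v.2
  | .halt => .halt

/-- A configuration of the oracle machine as a configuration of a program. -/
def liftCfg (A : List Letter) (c : TM2.Cfg T.tm.Γ T.tm.Λ T.tm.σ) :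
    TM2.Cfg (Alph T) T.tm.Λ (Var T) :=
  ⟨c.l, (none, c.var), stk [] A [] [] [] c.stk⟩

theorem stepAux_liftStmt (A : List Letter) (q : TM2.Stmt T.tm.Γ T.tm.Λ T.tm.σ) (v : T.tm.σ)
    (R : ∀ k, List (T.tm.Γ k)) :
    TM2.stepAux (liftStmt q) (none, v) (stk [] A [] [] [] R) =
      liftCfg A (TM2.stepAux q v R) := by
  induction q generalizing v R with
  | push k f q ih =>
    simp only [liftStmt, TM2.stepAux, stk_inr, update_stk_inr]
    exact ih _ _
  | peek k f q ih =>
    simp only [liftStmt, TM2.stepAux, stk_inr]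
    exact ih _ _
  | pop k f q ih =>
    simp only [liftStmt, TM2.stepAux, stk_inr, update_stk_inr]
    exact ih _ _
  | load f q ih => exact ih _ _
  | branch f q q' ih ih' =>
    simp only [liftStmt, TM2.stepAux]
    cases f v
    · exact ih' _ _
    · exact ih _ _
  | goto f => rfl
  | halt => rfl

theorem Reach.lift (A : List Letter) {n : ℕ} {c c' : TM2.Cfg T.tm.Γ T.tm.Λ T.tm.σ}
    (h : Reach T.tm.m n c c') :
    Reach (fun l => liftStmt (T.tm.m l)) n (liftCfg A c) (liftCfg A c') := by
  induction h with
  | refl => exact .refl _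
  | head _ ih => exact .cons (stepAux_liftStmt A _ _ _) ih

/-- The stacks of the oracle machine if only the stack `k` is in use. -/
abbrev only (k : T.tm.K) (s : List (T.tm.Γ k)) : ∀ k, List (T.tm.Γ k) :=
  Function.update (fun _ => []) k s

theorem only_nil (k : T.tm.K) : only k [] = fun _ => [] :=
  Function.update_eq_self k _

theorem initList_stk (s : List (T.tm.Γ T.tm.k₀)) : (initList T.tm s).stk = only T.tm.k₀ s := by
  funext k
  by_cases h : k = T.tm.k₀
  · subst h; simp [initList, only]
  · simp [initList, only, h]

theorem haltList_stk (s : List (T.tm.Γ T.tm.k₁)) : (haltList T.tm s).stk = only T.tm.k₁ s := by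
  funext k
  by_cases h : k = T.tm.k₁
  · subst h; simp [haltList, only]
  · simp [haltList, only, h]

namespace Prog

/-- Move a unary number from the main stack to the input stack of the oracle machine. -/
def feed : Prog T := single <|
  .pop (.inl .a) (fun v x => (x, v.2)) <|
  .branch (fun v => v.1 = some none)
    (.pop (.inl .a) (fun v _ => v) <|
      .push (.inr T.tm.k₀) (fun _ => T.inputAlphabet.symm .tick) <| .load reset <|
      .goto fun _ => ())
    (.load reset .halt)

theorem run_feed (m : ℕ) (A : List Letter) (s : List (T.tm.Γ T.tm.k₀)) :
    (feed : Prog T).Run (stk [] ((Enc.enc m).code ++ A) [] [] [] (only T.tm.k₀ s))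
      (stk [] A [] [] [] (only T.tm.k₀ (List.replicate m (T.inputAlphabet.symm .tick) ++ s)))
      (m + 1) := by
  induction m generalizing s with
  | zero =>
    refine run_single ?_
    simp [enc_nat, enc_nil, LTree.code]
  | succ m ih =>
    refine run_single_of_goto ?_ (by
      rw [List.replicate_succ', List.append_assoc]
      exact ih (T.inputAlphabet.symm .tick :: s))
    simp [enc_nat, List.replicate_succ, enc_cons, LTree.code, enc_unit]

/-- Run the oracle machine. -/
def call : Prog T where
  Λ := T.tm.Λ
  fin := T.tm.ΛFin
  entry := T.tm.main
  code l := liftStmt (T.tm.m l)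

/-- The oracle machine halts in its initial state with all stacks but the output empty. Once
`collect` has emptied that one too, the store is clean and the oracle can be called again. -/
theorem run_call (A : List Letter) {s : List (T.tm.Γ T.tm.k₀)} {s' : List (T.tm.Γ T.tm.k₁)} {N : ℕ}
    (h : TM2OutputsInTime T.tm s (some s') N) :
    (call : Prog T).Run (stk [] A [] [] [] (only T.tm.k₀ s))
      (stk [] A [] [] [] (only T.tm.k₁ s')) N := by
  obtain ⟨⟨n, hn⟩, hle⟩ := h
  have := (Reach.of_iterate (M := T.tm.m) hn).lift A
  refine ⟨n, hle, ?_⟩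
  rw [← initList_stk, ← haltList_stk]
  exact this

/-- Move the output of the oracle machine to a list on the main stack. -/
def collect : Prog T := (push (some none)).seq <| single <|
  .pop (.inr T.tm.k₁) (fun v x => (x.map fun s => some (some (T.outputAlphabet s)), v.2)) <|
  .branch (fun v => v.1 = none) .halt <|
  .push (.inl .a) (fun v => v.1.getD none) <| .push (.inl .a) (fun _ => none) <|
  .load reset <| .goto fun _ => ()

theorem run_collect (s : List Sym) (A : List Letter) :
    (collect : Prog T).Run (stk [] A [] [] [] (only T.tm.k₁ (s.map T.outputAlphabet.symm)))
      (main ((Enc.enc (s.map some : List Label).reverse).code ++ A)) (s.length + 2) := by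
  have key : ∀ (s : List Sym) (l : List Label),
      (single (.pop (.inr T.tm.k₁)
          (fun v x => (x.map fun s => some (some (T.outputAlphabet s)), v.2)) <|
        .branch (fun v => v.1 = none) .halt <|
        .push (.inl .a) (fun v => v.1.getD none) <| .push (.inl .a) (fun _ => none) <|
        .load reset <| .goto fun _ => ()) : Prog T).Run
      (stk [] ((Enc.enc l).code ++ A) [] [] [] (only T.tm.k₁ (s.map T.outputAlphabet.symm)))
      (main ((Enc.enc ((s.map some : List Label).reverse ++ l)).code ++ A)) (s.length + 1) := by
    intro s
    induction s with
    | nil =>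
      intro l
      refine run_single ?_
      simp
    | cons x s ih =>
      intro l
      refine run_single_of_goto ?_ (by
        rw [List.map_cons, List.reverse_cons, List.append_assoc]
        exact ih (some x :: l))
      simp [enc_cons, LTree.code, enc_label]
  have h := (run_push (some none) _ _ _ _ _ _).seq (key s [])
  rw [List.append_nil] at h
  exact h.mono (by omega)

end Prog

/-- The oracle machine yields a function computable in polynomial time. -/
theorem PolyTime.oracle {Y : Type} {eb : Y → List Sym} {f : ℕ → Y}
    (h : TM2ComputableInPolyTime (fun m : ℕ => List.replicate m Sym.tick) eb f)
    (p : Polynomial ℕ) (hp : ∀ m, (eb (f m)).length ≤ p.eval m) :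
    PolyTime h.toTM2ComputableAux fun m : ℕ => (((eb (f m)).map some).reverse : List Label) := by
  refine ⟨Prog.feed.seq (Prog.call.seq Prog.collect),
    2 * p + h.time + Polynomial.X + 3, fun m => ⟨?_, fun A => ?_⟩⟩
  · have h₁ := hp m
    have h₂ := eval_mono p (show m ≤ esize m by simp; omega)
    rw [esize_labels]
    simp only [List.length_reverse, List.length_map, Polynomial.eval_add, Polynomial.eval_mul,
      Polynomial.eval_X, Polynomial.eval_ofNat]
    omega
  · have h₁ := Prog.run_feed (T := h.toTM2ComputableAux) m A []
    rw [only_nil, List.append_nil] at h₁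
    have h₂ := Prog.run_call (T := h.toTM2ComputableAux) A (h.outputsFun m)
    rw [List.map_replicate] at h₂
    refine (h₁.seq (h₂.seq (Prog.run_collect (eb (f m)) A))).mono ?_
    have h₃ := hp m
    have h₄ := eval_mono p (show m ≤ esize m by simp; omega)
    have h₅ := eval_mono h.time (show m ≤ esize m by simp; omega)
    simp only [List.length_replicate, Polynomial.eval_add, Polynomial.eval_mul,
      Polynomial.eval_X, Polynomial.eval_ofNat]
    simp only [esize_nat] at h₄ h₅ ⊢
    omega

end Oracle

/-! ### Input and output -/

section InputOutput

variable {T : TM2ComputableAux Sym Sym}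

namespace Prog

/-- The statement that moves the input to the main stack. -/
def readStmt : PStmt T Unit :=
  .pop (.inl .io) (fun v x => (x.map some, v.2)) <| .branch (fun v => v.1 = none) .halt <|
  .push (.inl .a) (fun v => v.1.getD none) <| .push (.inl .a) (fun _ => none) <|
  .load reset <| .goto fun _ => ()

/-- Move the input to a list on the main stack. -/
def read : Prog T := (push (some none)).seq (single readStmt)

theorem run_read (w : List Label) :
    (read : Prog T).Run (stk w [] [] [] [] fun _ => []) (main (Enc.enc w.reverse).code)
      (w.length + 2) := by
  have key : ∀ (w l : List Label), (single readStmt : Prog T).Run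
      (stk w (Enc.enc l).code [] [] [] fun _ => []) (main (Enc.enc (w.reverse ++ l)).code)
      (w.length + 1) := by
    intro w
    induction w with
    | nil => exact fun l => run_single (by simp [readStmt])
    | cons x w ih =>
      intro l
      refine run_single_of_goto ?_ (by
        rw [List.reverse_cons, List.append_assoc]
        exact ih (x :: l))
      simp [readStmt, enc_cons, LTree.code, enc_label]
  have h := (run_push (some none) _ _ _ _ _ _).seq (key w [])
  rw [List.append_nil] at h
  exact h.mono (by omega)

/-- Move a list on the main stack to the output. -/
def write : Prog T := single <|
  .pop (.inl .a) (fun v x => (x, v.2)) <|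
  .branch (fun v => v.1 = some none)
    (.pop (.inl .a) (fun v x => (x, v.2)) <| .push (.inl .io) (fun v => (v.1.getD none).getD none) <|
      .load reset <| .goto fun _ => ())
    (.load reset .halt)

theorem run_write (l w : List Label) :
    (write : Prog T).Run (stk w (Enc.enc l).code [] [] [] fun _ => [])
      (stk (l.reverse ++ w) [] [] [] [] fun _ => []) (l.length + 1) := by
  induction l generalizing w with
  | nil => exact run_single (by simp [enc_nil, LTree.code])
  | cons x l ih =>
    refine run_single_of_goto ?_ (by
      rw [List.reverse_cons, List.append_assoc]
      exact ih (x :: w))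
    simp [enc_cons, LTree.code, enc_label]

variable (T) in
/-- A program as a machine. -/
def toFinTM2 (P : Prog T) : FinTM2 where
  K := Idx T
  kDecidableEq := inferInstance
  kFin := letI := T.tm.kFin; inferInstance
  k₀ := .inl .io
  k₁ := .inl .io
  Γ := Alph T
  Λ := P.Λ
  main := P.entry
  ΛFin := P.fin
  σ := Var T
  initialState := idle
  σFin := letI := T.tm.σFin; inferInstance
  Γk₀Fin := inferInstanceAs (Fintype (Option Sym))
  m := P.code

theorem initList_toFinTM2 (P : Prog T) (w : List Label) :
    initList (P.toFinTM2 T) w = ⟨some P.entry, idle, stk w [] [] [] [] fun _ => []⟩ := by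
  unfold initList
  congr 1
  funext k
  rcases k with (_ | _ | _ | _ | _) | k
  any_goals simp [toFinTM2]
  rfl

theorem haltList_toFinTM2 (P : Prog T) (w : List Label) :
    haltList (P.toFinTM2 T) w = ⟨none, idle, stk w [] [] [] [] fun _ => []⟩ := by
  unfold haltList
  congr 1
  funext k
  rcases k with (_ | _ | _ | _ | _) | k
  any_goals simp [toFinTM2]
  rfl

end Prog

/-- A function that is computed on lists, up to reversal, by a program in polynomial time can be
computed by a machine in polynomial time. -/
theorem PolyTime.nonempty_computable {X Y : Type} {ea : X → List Label} {eb : Y → List Label}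
    {f : X → Y} {F : List Label → List Label} (hF : PolyTime T F)
    (hf : ∀ x, eb (f x) = (F (ea x).reverse).reverse) :
    Nonempty (TM2ComputableInPolyTime ea eb f) := by
  obtain ⟨P, p, hP⟩ := hF
  refine ⟨⟨⟨(Prog.read.seq (P.seq Prog.write)).toFinTM2 T, Equiv.refl _, Equiv.refl _⟩,
    -- A list of `n` labels has a tree of size `2 * n + 1`. The value of `p` there is charged twice,
    -- for the run of `P` and for writing its output.
    Polynomial.X + 3 + 2 * p.comp (2 * Polynomial.X + 1), fun x => Classical.choice ?_⟩⟩
  obtain ⟨h₁, h₂⟩ := hP (ea x).reverse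
  have h₂ := h₂ []
  rw [List.append_nil, List.append_nil] at h₂
  have hrun := (Prog.run_read (T := T) (ea x)).seq (h₂.seq (Prog.run_write _ []))
  rw [List.append_nil, ← hf] at hrun
  obtain ⟨n, hn, hr⟩ := hrun
  refine ⟨⟨⟨n, ?_⟩, hn.trans ?_⟩⟩
  · have hi := (Prog.initList_toFinTM2 (Prog.read.seq (P.seq Prog.write)) ((ea x).map id)).trans
      (congrArg (fun w => (⟨some _, idle, stk w [] [] [] [] fun _ => []⟩ :
        TM2.Cfg (Alph T) _ (Var T))) (List.map_id _))
    have hh := (Prog.haltList_toFinTM2 (Prog.read.seq (P.seq Prog.write)) ((eb (f x)).map id)).trans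
      (congrArg (fun w => (⟨none, idle, stk w [] [] [] [] fun _ => []⟩ :
        TM2.Cfg (Alph T) _ (Var T))) (List.map_id _))
    exact (congrArg (fun c => (flip bind (TM2.step _))^[n] (some c)) hi).trans
      (hr.iterate_eq.trans (congrArg some hh.symm))
  · rw [esize_labels, esize_labels, List.length_reverse] at h₁
    rw [esize_labels, List.length_reverse]
    simp only [Polynomial.eval_add, Polynomial.eval_mul, Polynomial.eval_X,
      Polynomial.eval_ofNat, Polynomial.eval_comp, Polynomial.eval_one]
    omega

end InputOutput

end StackProgram

/-! ### A library of polynomial-time operations on Booleans, lists and unary numbers. -/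

namespace StackProgram

open Turing Voting
open LTree (leaf node)

namespace PolyTime

variable {T : TM2ComputableAux Sym Sym}
variable {X Y Z W : Type} [Enc X] [Enc Y] [Enc Z] [Enc W]

/-! ### Booleans and labels -/

theorem and {f g : X → Bool} (hf : PolyTime T f) (hg : PolyTime T g) :
    PolyTime T fun x => f x && g x := by
  have := hf.cond hg (const false)
  convert this using 2 with x
  cases f x <;> rfl

theorem not {f : X → Bool} (hf : PolyTime T f) : PolyTime T fun x => !f x := by
  have := hf.cond (const false) (const true)
  convert this using 2 with x
  cases f x <;> rfl

theorem eq_label {f : X → Label} (hf : PolyTime T f) (l : Label) :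
    PolyTime T fun x => decide (f x = l) :=
  (of_eq_leaf (f := fun y : Label => decide (y = l)) l fun y => by simp [enc_label]).comp hf

/-! ### Lists -/

theorem reverse {f : X → List Y} (hf : PolyTime T f) : PolyTime T fun x => (f x).reverse := by
  obtain ⟨p, hp⟩ := hf.esize_le
  have := foldl_of_add (h := fun y : X × List Y × Y => y.2.2 :: y.2.1) hf (const [])
    ((snd.comp snd).cons (fst.comp snd)) (p + 1) fun x b z hz => by
      have h₁ := esize_le_of_mem hz
      have h₂ := hp x
      simp only [esize_cons, Polynomial.eval_add, Polynomial.eval_one]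
      omega
  convert this using 2 with x
  simp

/-- Folds from the right in which each step increases the size at most by a polynomial. -/
theorem foldr_of_add {f : X → List Z} {g : X → Y} {h : X × Y × Z → Y} (hf : PolyTime T f)
    (hg : PolyTime T g) (hh : PolyTime T h) (r : Polynomial ℕ)
    (hr : ∀ x b z, z ∈ f x → esize (h (x, b, z)) ≤ esize b + r.eval (esize x)) :
    PolyTime T fun x => (f x).foldr (fun z b => h (x, b, z)) (g x) := by
  have := foldl_of_add hf.reverse hg hh r fun x b z hz => hr x b z (List.mem_reverse.1 hz)
  simpa only [List.foldl_reverse] using this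

theorem append {f g : X → List Y} (hf : PolyTime T f) (hg : PolyTime T g) :
    PolyTime T fun x => f x ++ g x := by
  obtain ⟨p, hp⟩ := hf.esize_le
  have := foldr_of_add (h := fun y : X × List Y × Y => y.2.2 :: y.2.1) hf hg
    ((snd.comp snd).cons (fst.comp snd)) (p + 1) fun x b z hz => by
      have h₁ := esize_le_of_mem hz
      have h₂ := hp x
      simp only [esize_cons, Polynomial.eval_add, Polynomial.eval_one]
      omega
  convert this using 2 with x
  simp

theorem exists_esize_le {f : X → List Z} {h : X × Z → Y} (hf : PolyTime T f)
    (hh : PolyTime T h) :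
    ∃ p : Polynomial ℕ, ∀ x, ∀ z ∈ f x, esize (h (x, z)) ≤ p.eval (esize x) := by
  obtain ⟨pf, hpf⟩ := hf.esize_le
  obtain ⟨ph, hph⟩ := hh.esize_le
  refine ⟨ph.comp (Polynomial.X + pf + 1), fun x z hz => (hph _).trans ?_⟩
  have h₁ := esize_le_of_mem hz
  have h₂ := hpf x
  rw [Polynomial.eval_comp]
  refine eval_mono ph ?_
  simp only [esize_prod, Polynomial.eval_add, Polynomial.eval_X, Polynomial.eval_one]
  omega

theorem flatMap {f : X → List Z} {h : X × Z → List Y} (hf : PolyTime T f) (hh : PolyTime T h) :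
    PolyTime T fun x => (f x).flatMap fun z => h (x, z) := by
  obtain ⟨p, hp⟩ := exists_esize_le hf hh
  have := foldr_of_add (h := fun y : X × List Y × Z => h (y.1, y.2.2) ++ y.2.1) hf (const [])
    ((hh.comp (fst.pair (snd.comp snd))).append (fst.comp snd)) p fun x b z hz => by
      have h₁ := hp x z hz
      have h₂ := esize_append (h (x, z)) b
      simp only
      omega
  convert this using 2 with x
  induction f x with
  | nil => rfl
  | cons z l ih => simp [ih]

theorem map {f : X → List Z} {h : X × Z → Y} (hf : PolyTime T f) (hh : PolyTime T h) :
    PolyTime T fun x => (f x).map fun z => h (x, z) := by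
  have := flatMap hf (hh.cons (const []))
  convert this using 2 with x
  exact List.map_eq_flatMap

theorem filter {f : X → List Z} {h : X × Z → Bool} (hf : PolyTime T f) (hh : PolyTime T h) :
    PolyTime T fun x => (f x).filter fun z => h (x, z) := by
  have := flatMap hf (hh.cond (snd.cons (const [])) (const []))
  convert this using 2 with x
  induction f x with
  | nil => rfl
  | cons z l ih =>
    rw [List.filter_cons, List.flatMap_cons, ← ih]
    cases h (x, z) <;> simp

theorem all {f : X → List Z} {h : X × Z → Bool} (hf : PolyTime T f) (hh : PolyTime T h) :
    PolyTime T fun x => (f x).all fun z => h (x, z) := by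
  have := (filter hf hh.not).isEmpty
  convert this using 2 with x
  rw [Bool.eq_iff_iff]
  simp

/-! ### Natural numbers -/

theorem units {f : X → ℕ} (hf : PolyTime T f) : PolyTime T fun x => List.replicate (f x) () :=
  (of_enc_eq (f := fun n : ℕ => List.replicate n ()) fun _ => rfl).comp hf

theorem of_units {f : X → List Unit} (hf : PolyTime T f) : PolyTime T fun x => (f x).length :=
  (of_enc_eq (f := fun l : List Unit => l.length) fun l => by
    rw [enc_nat]; congr 1; exact (List.eq_replicate_of_mem fun _ _ => rfl).symm).comp hf

theorem length {f : X → List Y} (hf : PolyTime T f) : PolyTime T fun x => (f x).length := by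
  simpa using (map hf (const ())).of_units

theorem succ {f : X → ℕ} (hf : PolyTime T f) : PolyTime T fun x => f x + 1 := by
  simpa using ((const ()).cons hf.units).of_units

theorem pred {f : X → ℕ} (hf : PolyTime T f) : PolyTime T fun x => (f x).pred := by
  simpa using (tail.comp hf.units).of_units

/-- Iterations in which each step increases the size at most by a polynomial. -/
theorem iterate_of_add {n : X → ℕ} {g : X → Y} {h : X × Y → Y} (hn : PolyTime T n)
    (hg : PolyTime T g) (hh : PolyTime T h) (r : Polynomial ℕ)
    (hr : ∀ x b, esize (h (x, b)) ≤ esize b + r.eval (esize x)) :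
    PolyTime T fun x => (fun b => h (x, b))^[n x] (g x) := by
  have := foldl_of_add (h := fun y : X × Y × Unit => h (y.1, y.2.1)) hn.units hg
    (hh.comp (fst.pair (fst.comp snd))) r fun x b _ _ => hr x b
  convert this using 2 with x
  have e := List.foldl_const (fun b => h (x, b)) (g x) (List.replicate (n x) ())
  rw [List.length_replicate] at e
  exact e.symm

theorem add {f g : X → ℕ} (hf : PolyTime T f) (hg : PolyTime T g) :
    PolyTime T fun x => f x + g x := by
  simpa using ((hf.units).append (hg.units)).of_units

theorem sub {f g : X → ℕ} (hf : PolyTime T f) (hg : PolyTime T g) :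
    PolyTime T fun x => f x - g x := by
  have := iterate_of_add (h := fun y : X × ℕ => y.2.pred) hg hf snd.pred 0 fun x b => by
    have := Nat.pred_le b
    simp only [esize_nat]
    omega
  convert this using 2 with x
  exact (Nat.pred_iterate _ _).symm

theorem mul {f g : X → ℕ} (hf : PolyTime T f) (hg : PolyTime T g) :
    PolyTime T fun x => f x * g x := by
  have := (flatMap hf.units (hg.comp fst).units).of_units
  convert this using 2 with x
  simp

theorem isZero {f : X → ℕ} (hf : PolyTime T f) : PolyTime T fun x => decide (f x = 0) := by
  have := hf.units.isEmpty
  convert this using 2 with x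
  cases f x <;> simp

theorem le {f g : X → ℕ} (hf : PolyTime T f) (hg : PolyTime T g) :
    PolyTime T fun x => decide (f x ≤ g x) := by
  simpa only [Nat.sub_eq_zero_iff_le] using (hf.sub hg).isZero

theorem lt {f g : X → ℕ} (hf : PolyTime T f) (hg : PolyTime T g) :
    PolyTime T fun x => decide (f x < g x) :=
  hf.succ.le hg

theorem eq_nat {f g : X → ℕ} (hf : PolyTime T f) (hg : PolyTime T g) :
    PolyTime T fun x => decide (f x = g x) := by
  have := (hf.le hg).and (hg.le hf)
  convert this using 2 with x
  rw [← Bool.decide_and, decide_eq_decide]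
  omega

theorem min {f g : X → ℕ} (hf : PolyTime T f) (hg : PolyTime T g) :
    PolyTime T fun x => min (f x) (g x) := by
  have := (hf.le hg).cond hf hg
  convert this using 2 with x
  by_cases h : f x ≤ g x
  · simp [h]
  · simp [h, min_eq_right (not_le.1 h).le]

theorem polynomial_eval {f : X → ℕ} (hf : PolyTime T f) (q : Polynomial ℕ) :
    PolyTime T fun x => q.eval (f x) := by
  induction q using Polynomial.induction_on with
  | C a => simpa only [Polynomial.eval_C] using const a
  | add p q hp hq => simpa only [Polynomial.eval_add] using hp.add hq
  | monomial n a h =>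
    have := h.mul hf
    convert this using 2 with x
    simp [pow_succ, mul_assoc]

/-! ### Lists and natural numbers -/

theorem sum {f : X → List ℕ} (hf : PolyTime T f) : PolyTime T fun x => (f x).sum := by
  have := (flatMap hf (snd (T := T) (X := X) (Y := ℕ)).units).of_units
  convert this using 2 with x
  simp [List.length_flatMap]

theorem replicate {n : X → ℕ} {f : X → Y} (hn : PolyTime T n) (hf : PolyTime T f) :
    PolyTime T fun x => List.replicate (n x) (f x) := by
  simpa using map hn.units (hf.comp fst)

theorem range {n : X → ℕ} (hn : PolyTime T n) : PolyTime T fun x => List.range (n x) := by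
  have hfold : ∀ l : List Unit, l.foldl (fun b _ => b ++ [b.length]) [] = List.range l.length :=
    fun l => by
      induction l using List.reverseRecOn with
      | nil => rfl
      | append_singleton l u ih => simp [ih, List.range_succ]
  have hsize : ∀ k, esize (List.range k) ≤ 1 + k * (2 * k + 2) := fun k => by
    induction k with
    | zero => simp
    | succ k ih =>
      have := esize_append (List.range k) [k]
      rw [List.range_succ]
      simp only [esize_cons, esize_nat, esize_nil] at this
      nlinarith
  obtain ⟨p, hp⟩ := hn.esize_le
  -- The length of the accumulator is the next number to append. The growth of a step thus depends
  -- on the accumulator and not on `x` alone, so `foldl_of_add` does not apply and the size is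
  -- bounded directly.
  have := foldl (h := fun y : X × List ℕ × Unit => y.2.1 ++ [y.2.1.length]) hn.units (const [])
    ((fst.comp snd).append ((fst.comp snd).length.cons (const []))) (1 + p * (2 * p + 2))
    fun x l hl => by
      have h₁ := hl.length_le
      have h₂ := hp x
      rw [List.length_replicate] at h₁
      rw [esize_nat] at h₂
      rw [hfold]
      refine (hsize _).trans ?_
      simp only [Polynomial.eval_add, Polynomial.eval_one, Polynomial.eval_mul,
        Polynomial.eval_ofNat]
      gcongr <;> omega
  convert this using 2 with x
  rw [hfold, List.length_replicate]

theorem getD {l : X → List Y} {n : X → ℕ} (hl : PolyTime T l) (hn : PolyTime T n) (d : Y) :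
    PolyTime T fun x => (l x).getD (n x) d := by
  have := (iterate_of_add (h := fun y : X × List Y => y.2.tail) hn hl (tail.comp snd) 0
    fun x b => by cases b <;> simp; omega).headD d
  convert this using 2 with x
  have key : ∀ (n : ℕ) (l : List Y), l.getD n d = ((fun b => b.tail)^[n] l).headD d := fun n => by
    induction n with
    | zero => intro l; cases l <;> rfl
    | succ n ih =>
      intro l
      rw [Function.iterate_succ_apply, ← ih]
      cases l <;> simp
  exact key _ _

theorem idxOf {l : X → List ℕ} {a : X → ℕ} (hl : PolyTime T l) (ha : PolyTime T a) :
    PolyTime T fun x => (l x).idxOf (a x) := by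
  have := foldr_of_add
    (h := fun y : X × ℕ × ℕ => bif decide (y.2.2 = a y.1) then 0 else y.2.1 + 1) hl (const 0)
    (((snd.comp snd).eq_nat (ha.comp fst)).cond (const 0) (fst.comp snd).succ) 2
    fun x b z _ => by
      simp only [esize_nat, Polynomial.eval_ofNat]
      cases decide (z = a x) <;> simp
      omega
  convert this using 2 with x
  induction l x with
  | nil => rfl
  | cons z l ih => rw [List.idxOf_cons, List.foldr_cons, ← ih]; rfl

theorem rotate {l : X → List ℕ} {n : X → ℕ} (hl : PolyTime T l) (hn : PolyTime T n) :
    PolyTime T fun x => (l x).rotate (n x) := by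
  have := iterate_of_add
    (h := fun y : X × List ℕ => bif y.2.isEmpty then y.2 else y.2.tail ++ [y.2.headD 0]) hn hl
    (snd.isEmpty.cond snd ((tail.comp snd).append ((snd.headD 0).cons (const [])))) 0
    fun x b => by
      cases b with
      | nil => simp
      | cons z b =>
        have := esize_append b [z]
        simp only [List.isEmpty_cons, cond_false, List.tail_cons, List.headD_cons, esize_cons,
          esize_nil] at *
        omega
  convert this using 2 with x
  have key : ∀ (n : ℕ) (l : List ℕ), l.rotate n =
      (fun b : List ℕ => bif b.isEmpty then b else b.tail ++ [b.headD 0])^[n] l := fun n => by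
    induction n with
    | zero => intro l; simp
    | succ n ih =>
      intro l
      rw [Function.iterate_succ_apply, ← ih]
      cases l <;> simp
  exact key _ _

end PolyTime

end StackProgram

/-! ### Combinatorics of the reduction: gadget votes, the dummy candidate, equivalence of instances.
-/

namespace Voting

/-! ### Votes as rows of numbers -/

/-- The row of a vote: the candidates from the most to the least preferred. -/
def Vote.row {m : ℕ} (v : Vote m) : List ℕ := List.ofFn fun i => (v i : ℕ)

@[simp] theorem Vote.length_row {m : ℕ} (v : Vote m) : v.row.length = m := by simp [Vote.row]

theorem Vote.idxOf_row {m : ℕ} (v : Vote m) (x : Fin m) :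
    v.row.idxOf (x : ℕ) = (v.symm x : ℕ) := by
  have hn : v.row.Nodup := List.nodup_ofFn_ofInjective
    (Fin.val_injective.comp v.injective)
  have := hn.idxOf_getElem (v.symm x : ℕ) (by simp)
  simpa [Vote.row] using this

theorem Vote.mem_row {m : ℕ} (v : Vote m) {x : ℕ} (hx : x < m) : x ∈ v.row := by
  rw [← List.idxOf_lt_length_iff, v.idxOf_row ⟨x, hx⟩]
  simp

/-- With only `m` entries there is no room for repetitions, so `idxOf` is a bijection from
candidates to positions. -/
theorem exists_vote_of_row {m : ℕ} {r : List ℕ} (hr : r.length = m) (h : ∀ i < m, i ∈ r) :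
    ∃ v : Vote m, v.row = r := by
  have hlt : ∀ x : Fin m, r.idxOf (x : ℕ) < m := fun x =>
    (List.idxOf_lt_length_iff.2 (h x x.2)).trans_eq hr
  have hinj : Function.Injective fun x : Fin m => (⟨r.idxOf (x : ℕ), hlt x⟩ : Fin m) :=
    fun x y hxy => Fin.ext ((List.idxOf_inj (h x x.2)).1 (Fin.mk.inj_iff.1 hxy))
  let e := Equiv.ofBijective _ (Finite.injective_iff_bijective.1 hinj)
  refine ⟨e.symm, List.ext_getElem (by simp [hr]) fun i h₁ h₂ => ?_⟩
  have he : e (e.symm ⟨i, hr ▸ h₂⟩) = ⟨i, hr ▸ h₂⟩ := e.apply_symm_apply _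
  have he' : r.idxOf ((e.symm ⟨i, hr ▸ h₂⟩ : Fin m) : ℕ) = i := congrArg Fin.val he
  simp only [Vote.row, List.getElem_ofFn]
  have := List.getElem_idxOf (List.idxOf_lt_length_iff.2 (h _ (e.symm ⟨i, hr ▸ h₂⟩).2))
  simp only [he'] at this
  exact this.symm

/-- The vote that arises from `v` by moving the first `i` candidates to the end. -/
def Vote.rotate {n : ℕ} (v : Vote (n + 1)) (i : Fin (n + 1)) : Vote (n + 1) :=
  (Equiv.addRight i).trans v

theorem Vote.row_rotate {n : ℕ} (v : Vote (n + 1)) (i : Fin (n + 1)) :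
    (v.rotate i).row = v.row.rotate i := by
  refine List.ext_getElem (by simp) fun k h₁ h₂ => ?_
  rw [List.getElem_rotate]
  simp only [Vote.row, List.getElem_ofFn, Vote.rotate, Equiv.trans_apply, Equiv.coe_addRight]
  congr 2
  ext
  simp [Fin.val_add]

/-! ### Scores -/

variable {α : ScoreVectors}

theorem score_append {m : ℕ} (P Q : List (Vote m)) (x : Fin m) :
    score α (P ++ Q) x = score α P x + score α Q x := by
  simp [score]

theorem score_cons {m : ℕ} (v : Vote m) (P : List (Vote m)) (x : Fin m) :
    score α (v :: P) x = α m (v.symm x) + score α P x := by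
  simp [score]

theorem score_flatMap {m : ℕ} {ι : Type*} (l : List ι) (F : ι → List (Vote m)) (x : Fin m) :
    score α (l.flatMap F) x = (l.map fun i => score α (F i) x).sum := by
  induction l with
  | nil => rfl
  | cons i l ih => rw [List.flatMap_cons, score_append, ih, List.map_cons, List.sum_cons]

theorem score_le {m : ℕ} {P : List (Vote m)} {x : Fin m} {a : ℕ}
    (h : ∀ v ∈ P, α m (v.symm x) ≤ a) : score α P x ≤ P.length * a := by
  have := List.sum_le_card_nsmul (P.map fun v => α m (v.symm x)) a (by simpa using h)
  simpa [score] using this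

theorem scoringRule_eq_singleton {m : ℕ} {P : List (Vote m)} {c : Fin m} :
    scoringRule α m P = {c} ↔ ∀ x, x ≠ c → score α P x < score α P c := by
  constructor
  · intro h x hx
    have hc : ∀ y, score α P y ≤ score α P c := (h ▸ rfl : c ∈ scoringRule α m P)
    refine (hc x).lt_of_ne fun heq => hx ?_
    have : x ∈ scoringRule α m P := fun y => heq ▸ hc y
    rwa [h] at this
  · intro h
    have hc : ∀ y, score α P y ≤ score α P c := fun y => by
      rcases eq_or_ne y c with rfl | hy
      exacts [le_rfl, (h y hy).le]
    ext x
    refine ⟨fun hx => ?_, fun hx => ?_⟩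
    · by_contra hne
      exact absurd (hx c) (not_le.2 (h x hne))
    · rw [Set.mem_singleton_iff.1 hx]
      exact hc

/-- The sum of the scores of a candidate over all rotations of a vote. -/
theorem sum_rotate {n : ℕ} (v : Vote (n + 1)) (x : Fin (n + 1)) :
    ∑ i, α (n + 1) ((v.rotate i).symm x) = ∑ i, α (n + 1) i := by
  -- Positions shift cyclically, so over all `i` the candidate takes every position exactly once.
  have : ∀ i, (v.rotate i).symm x = v.symm x - i := fun i => by
    simp [Vote.rotate, sub_eq_add_neg]
  simp only [this]
  exact Equiv.sum_comp (Equiv.subLeft (v.symm x)) (α (n + 1))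

/-! ### Raising the score of one candidate -/

/-- The candidates other than `x`, in their natural order. -/
def others (m x : ℕ) : List ℕ := (List.range m).filter fun y => decide (y ≠ x)

/-- Votes that give one more point to the candidate `x` and one point less to the candidate `m`
than to the other ones. -/
def raise (m x : ℕ) : List (List ℕ) :=
  (others m x ++ [x, m]) :: (List.range m).map fun i => (others m x ++ [m, x]).rotate (i + 1)

theorem length_others {m x : ℕ} (hx : x < m) : (others m x).length + 1 = m := by
  have h : others m x = (List.range m).erase x := by
    rw [List.nodup_range.erase_eq_filter]
    refine List.filter_congr fun y _ => ?_
    by_cases hy : y = x <;> simp [hy]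
  rw [h, List.length_erase_of_mem (by simpa using hx), List.length_range]
  omega

theorem mem_others {m x y : ℕ} : y ∈ others m x ↔ y < m ∧ y ≠ x := by
  simp [others]

theorem exists_vote_others {m : ℕ} {x y z : ℕ} (hx : x < m) (h : (y = x ∧ z = m) ∨ y = m ∧ z = x) :
    ∃ v : Vote (m + 1), v.row = others m x ++ [y, z] := by
  refine exists_vote_of_row ?_ fun i hi => ?_
  · have := length_others hx
    simp only [List.length_append, List.length_cons, List.length_nil]
    omega
  · simp only [List.mem_append, mem_others, List.mem_cons, List.not_mem_nil, or_false]
    omega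

/-- All rotations of `v`, which ends in the dummy and `x`, would give everyone the full sum of the
vector. Replacing the unrotated `v` by `w`, with the last two swapped, changes only the scores of
these two: the final entries `1, 0` make `x` gain a point and the dummy lose one. -/
theorem exists_votes_raise (h₁ : ∀ n, α (n + 2) (Fin.last (n + 1)) = 0)
    (h₂ : ∀ n, α (n + 2) (Fin.last n).castSucc = 1) {m : ℕ} (x : Fin m) :
    ∃ V : List (Vote (m + 1)), V.map Vote.row = raise m x ∧
      (∀ y : Fin m, score α V y.castSucc = (∑ i, α (m + 1) i) + if y = x then 1 else 0) ∧
      score α V (Fin.last m) + 1 = ∑ i, α (m + 1) i := by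
  obtain ⟨v, hv⟩ := exists_vote_others (m := m) x.2 (.inr ⟨rfl, rfl⟩)
  obtain ⟨w, hw⟩ := exists_vote_others (m := m) x.2 (.inl ⟨rfl, rfl⟩)
  have hl := length_others x.2
  let V := w :: List.ofFn fun i : Fin m => v.rotate i.succ
  have hsum : ∀ y, score α V y + α (m + 1) (v.symm y) =
      (∑ i, α (m + 1) i) + α (m + 1) (w.symm y) := fun y => by
    have hs := sum_rotate (α := α) v y
    rw [Fin.sum_univ_succ] at hs
    have h0 : v.rotate 0 = v := by ext; simp [Vote.rotate]
    rw [h0] at hs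
    rw [← hs]
    have hr : score α (List.ofFn fun i : Fin m => v.rotate i.succ) y =
        ∑ i : Fin m, α (m + 1) ((v.rotate i.succ).symm y) := by
      simp [score, List.map_ofFn, List.sum_ofFn, Function.comp_def]
    rw [score_cons, hr]
    ring
  have hv' := fun y => v.idxOf_row y
  have hw' := fun y => w.idxOf_row y
  rw [hv] at hv'
  rw [hw] at hw'
  have hlast : ∀ {i : Fin (m + 1)}, (i : ℕ) = m → α (m + 1) i = 0 := fun {i} hi => by
    obtain ⟨n, rfl⟩ : ∃ n, m = n + 1 := ⟨m - 1, by omega⟩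
    exact (congrArg _ (Fin.ext (by simpa using hi))).trans (h₁ n)
  have hprev : ∀ {i : Fin (m + 1)}, (i : ℕ) + 1 = m → α (m + 1) i = 1 := fun {i} hi => by
    obtain ⟨n, rfl⟩ : ∃ n, m = n + 1 := ⟨m - 1, by omega⟩
    exact (congrArg _ (Fin.ext (by simp; omega))).trans (h₂ n)
  have hnx : (x : ℕ) ∉ others m x := fun h => (mem_others.1 h).2 rfl
  have hnm : m ∉ others m x := fun h => (mem_others.1 h).1.false
  have hxm : (x : ℕ) ≠ m := x.2.ne
  have hvx : α (m + 1) (v.symm x.castSucc) = 0 := hlast (by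
    rw [← hv', Fin.val_castSucc, List.idxOf_append_of_notMem hnx]; simp [hxm.symm]; omega)
  have hwx : α (m + 1) (w.symm x.castSucc) = 1 := hprev (by
    rw [← hw', Fin.val_castSucc, List.idxOf_append_of_notMem hnx]; simp; omega)
  have hvm : α (m + 1) (v.symm (Fin.last m)) = 1 := hprev (by
    rw [← hv', Fin.val_last, List.idxOf_append_of_notMem hnm]; simp; omega)
  have hwm : α (m + 1) (w.symm (Fin.last m)) = 0 := hlast (by
    rw [← hw', Fin.val_last, List.idxOf_append_of_notMem hnm]; simp [hxm]; omega)
  refine ⟨V, ?_, fun y => ?_, ?_⟩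
  · simp only [V, raise, List.map_cons, hw, List.map_ofFn, ← hv]
    congr 1
    refine List.ext_getElem (by simp) fun i _ _ => ?_
    simp [Vote.row_rotate]
  · have hy := hsum y.castSucc
    split_ifs with h
    · subst h; omega
    · have hmem : (y : ℕ) ∈ others m x := mem_others.2 ⟨y.2, fun e => h (Fin.ext e)⟩
      have : v.symm y.castSucc = w.symm y.castSucc := by
        ext
        rw [← hv', ← hw', Fin.val_castSucc, List.idxOf_append_of_mem hmem,
          List.idxOf_append_of_mem hmem]
      rw [this] at hy
      omega
  · have hy := hsum (Fin.last m)
    omega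

/-! ### Adding and removing a candidate -/

theorem exists_vote_rank {n : ℕ} {f : Fin n → ℕ} (hf : Function.Injective f) :
    ∃ v : Vote n, ∀ x, (v.symm x : ℕ) = (Finset.univ.filter fun y => f y < f x).card := by
  have hlt : ∀ x, (Finset.univ.filter fun y => f y < f x).card < n := fun x => by
    have := Finset.card_lt_univ_of_notMem (x := x) (s := Finset.univ.filter fun y => f y < f x)
      (by simp)
    simpa using this
  have hmono : ∀ x y, f x < f y → (Finset.univ.filter fun z => f z < f x).card <
      (Finset.univ.filter fun z => f z < f y).card := fun x y hxy => by
    refine Finset.card_lt_card (Finset.ssubset_iff_of_subset ?_ |>.2 ⟨x, by simpa using hxy, by simp⟩)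
    intro z hz
    simp only [Finset.mem_filter, Finset.mem_univ, true_and] at hz ⊢
    omega
  have hinj : Function.Injective fun x : Fin n =>
      (⟨(Finset.univ.filter fun y => f y < f x).card, hlt x⟩ : Fin n) := fun x y hxy => by
    have hxy := Fin.mk.inj_iff.1 hxy
    refine hf ?_
    rcases lt_trichotomy (f x) (f y) with h | h | h
    · have := hmono x y h; omega
    · exact h
    · have := hmono y x h; omega
  exact ⟨(Equiv.ofBijective _ (Finite.injective_iff_bijective.1 hinj)).symm, fun x => rfl⟩

theorem card_filter_symm_lt {n : ℕ} (v : Vote n) (x : Fin n) :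
    (Finset.univ.filter fun y => v.symm y < v.symm x).card = v.symm x := by
  have : (Finset.univ.filter fun y => v.symm y < v.symm x) =
      (Finset.Iio (v.symm x)).map v.toEmbedding := by
    ext y
    simp [Finset.mem_map_equiv]
  rw [this, Finset.card_map, Fin.card_Iio]

/-- Put `c` first and the new candidate second. -/
theorem exists_vote_extend {m : ℕ} (c : Fin m) (v : Vote m) :
    ∃ w : Vote (m + 1), (w.symm c.castSucc : ℕ) = 0 ∧
      ∀ x, x ≠ c → (v.symm x : ℕ) + 1 ≤ w.symm x.castSucc := by
  let f : Fin (m + 1) → ℕ :=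
    Fin.lastCases 1 fun x => if x = c then 0 else (v.symm x : ℕ) + 2
  have hc : f c.castSucc = 0 := by simp [f]
  have hl : f (Fin.last m) = 1 := by simp [f]
  have hx : ∀ x, x ≠ c → f x.castSucc = (v.symm x : ℕ) + 2 := fun x h => by simp [f, h]
  have hf : Function.Injective f := by
    intro x y hxy
    induction x using Fin.lastCases with
    | last =>
      induction y using Fin.lastCases with
      | last => rfl
      | cast y =>
        rcases eq_or_ne y c with rfl | hy
        · omega
        · rw [hl, hx y hy] at hxy; omega
    | cast x =>
      induction y using Fin.lastCases with
      | last =>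
        rcases eq_or_ne x c with rfl | h
        · omega
        · rw [hl, hx x h] at hxy; omega
      | cast y =>
        rcases eq_or_ne x c with rfl | h <;> rcases eq_or_ne y x with rfl | h'
        · rfl
        · rw [hc, hx y h'] at hxy; omega
        · rfl
        · rcases eq_or_ne y c with rfl | h''
          · rw [hc, hx x h] at hxy; omega
          · rw [hx x h, hx y h''] at hxy
            exact absurd (v.symm.injective (Fin.ext (by omega : (v.symm y : ℕ) = v.symm x))) h'
  obtain ⟨w, hw⟩ := exists_vote_rank hf
  refine ⟨w, by simp [hw, hc], fun x h => ?_⟩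
  rw [hw, hx x h]
  have hcard := card_filter_symm_lt v x
  -- The dummy, `c` and everyone ahead of `x` in `v` precede `x` in `w`. As `c` may already have
  -- been ahead of `x`, only the dummy surely adds to the count.
  have hsub : insert (Fin.last m) ((insert c (Finset.univ.filter
      fun y => v.symm y < v.symm x)).map Fin.castSuccEmb) ⊆
      Finset.univ.filter fun y => f y < (v.symm x : ℕ) + 2 := by
    intro y hy
    simp only [Finset.mem_insert, Finset.mem_map, Finset.mem_filter, Finset.mem_univ,
      true_and, Fin.coe_castSuccEmb] at hy ⊢
    rcases hy with rfl | ⟨y, rfl | hy, rfl⟩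
    · omega
    · omega
    · rcases eq_or_ne y c with rfl | h'
      · omega
      · rw [hx y h']
        have : (v.symm y : ℕ) < v.symm x := hy
        omega
  have h₁ := Finset.card_le_card hsub
  rw [Finset.card_insert_of_notMem (by
    simp only [Finset.mem_map, not_exists, not_and]
    exact fun y _ => (Fin.castSucc_lt_last y).ne), Finset.card_map] at h₁
  have h₂ := Finset.card_le_card (Finset.subset_insert c (Finset.univ.filter
      fun y => v.symm y < v.symm x))
  rw [hcard] at h₂
  omega

/-- Put `c` first and remove the last candidate. -/
theorem exists_vote_restrict {m : ℕ} (c : Fin m) (w : Vote (m + 1)) :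
    ∃ v : Vote m, (v.symm c : ℕ) = 0 ∧
      ∀ x, x ≠ c → (w.symm x.castSucc : ℕ) ≤ v.symm x + 1 := by
  let f : Fin m → ℕ := fun x => if x = c then 0 else (w.symm x.castSucc : ℕ) + 1
  have hc : f c = 0 := by simp [f]
  have hx : ∀ x, x ≠ c → f x = (w.symm x.castSucc : ℕ) + 1 := fun x h => by simp [f, h]
  have hf : Function.Injective f := by
    intro x y hxy
    rcases eq_or_ne x c with rfl | h <;> rcases eq_or_ne y x with rfl | h'
    · rfl
    · rw [hc, hx y h'] at hxy; omega
    · rfl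
    · rcases eq_or_ne y c with rfl | h''
      · rw [hc, hx x h] at hxy; omega
      · rw [hx x h, hx y h''] at hxy
        exact Fin.castSucc_injective m (w.symm.injective (Fin.ext (by omega)))
  obtain ⟨v, hv⟩ := exists_vote_rank hf
  refine ⟨v, by simp [hv, hc], fun x h => ?_⟩
  rw [hv, hx x h]
  have hcard := card_filter_symm_lt w x.castSucc
  -- Everyone ahead of `x` in `w`, except possibly the dummy, is still ahead of `x` in `v`; so the
  -- position drops by at most one.
  have hsub : (Finset.univ.filter fun y => w.symm y < w.symm x.castSucc) ⊆
      insert (Fin.last m) ((Finset.univ.filter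
        fun y => f y < (w.symm x.castSucc : ℕ) + 1).map Fin.castSuccEmb) := by
    intro y hy
    simp only [Finset.mem_insert, Finset.mem_map, Finset.mem_filter, Finset.mem_univ,
      true_and, Fin.coe_castSuccEmb] at hy ⊢
    induction y using Fin.lastCases with
    | last => exact .inl rfl
    | cast y =>
      refine .inr ⟨y, ?_, rfl⟩
      rcases eq_or_ne y c with rfl | h'
      · omega
      · rw [hx y h']
        have : (w.symm y.castSucc : ℕ) < w.symm x.castSucc := hy
        omega
  have h₁ := Finset.card_le_card hsub
  have h₂ := Finset.card_insert_le (Fin.last m) ((Finset.univ.filter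
        fun y => f y < (w.symm x.castSucc : ℕ) + 1).map Fin.castSuccEmb)
  rw [Finset.card_map] at h₂
  omega

/-! ### Reducing an instance -/

/-- Let `P'` be votes with one additional candidate, such that the scores from `P'` differ from
those from `P` in a suitable way, but large differences are cut off. Then `P` and `P'` yield
equivalent instances. -/
theorem isYes_iff (hanti : ∀ m, Antitone (α m))
    (hext : ∀ m, 2 ≤ m → ∀ i : Fin m, α (m + 1) i.succ = α m i)
    {m : ℕ} {c : Fin m} {P : List (Vote m)} {P' : List (Vote (m + 1))} {t a₀ a₁ S : ℕ}
    {g : Fin m → ℕ} (ha₀ : ∀ i : Fin (m + 1), (i : ℕ) = 0 → α (m + 1) i = a₀)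
    (ha₁ : ∀ i : Fin (m + 1), (i : ℕ) = 1 → α (m + 1) i = a₁)
    (hP : ∀ x : Fin m, score α P' x.castSucc = S + g x) (hlast : score α P' (Fin.last m) ≤ S)
    (hc : g c = t * a₀ + 1 - t * (a₀ - a₁))
    (hx : ∀ x, x ≠ c → g x =
      min (score α P x + (t * a₀ + 1) - score α P c) (2 * (t * a₀ + 1))) :
    (CMInstance.mk m P t c).IsYes (scoringRule α) ↔
      (CMInstance.mk (m + 1) P' t c.castSucc).IsYes (scoringRule α) := by
  have hm : 0 < m := c.pos
  have hle₀ : ∀ i, α (m + 1) i ≤ a₀ := fun i =>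
    (hanti _ (Fin.zero_le i)).trans_eq (ha₀ 0 rfl)
  have hle₁ : ∀ i : Fin (m + 1), 1 ≤ (i : ℕ) → α (m + 1) i ≤ a₁ := fun i hi =>
    (hanti _ (show (⟨1, by omega⟩ : Fin (m + 1)) ≤ i from hi)).trans_eq (ha₁ _ rfl)
  have h01 : a₁ ≤ a₀ := (ha₁ ⟨1, by omega⟩ rfl).symm.trans_le (hle₀ _)
  -- Hence `g c = t * a₁ + 1`. Ranked first by all manipulators, `c` gains `t * a₀` in the new
  -- election but `t * a₁` in the old one; the lower value of `g c` compensates for this.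
  have hG : t * (a₀ - a₁) + t * a₁ = t * a₀ := by
    rw [← Nat.mul_add]; congr 1; omega
  -- `hext` is only available for at least two candidates; with a single one there is no rival to
  -- compare.
  have hm2 : ∀ x, x ≠ c → 2 ≤ m := fun x hxc => by
    have := Fin.val_ne_of_ne hxc
    omega
  unfold CMInstance.IsYes
  simp only [scoringRule_eq_singleton, score_append]
  constructor
  · rintro ⟨M, rfl, hM⟩
    choose F hF₀ hF using exists_vote_extend c
    have hFc : score α (M.map F) c.castSucc = M.length * a₀ := by
      simp only [score, List.map_map]
      rw [List.map_congr_left (g := fun _ => a₀) fun v _ => by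
        rw [Function.comp_apply]
        exact ha₀ _ (hF₀ v)]
      simp
    refine ⟨M.map F, by simp, fun y => ?_⟩
    induction y using Fin.lastCases with
    | last =>
      intro _
      have h₁ : score α (M.map F) (Fin.last m) ≤ (M.map F).length * a₀ :=
        score_le fun v _ => hle₀ _
      rw [List.length_map] at h₁
      rw [hP, hFc]
      omega
    | cast x =>
      intro hne
      have hxc : x ≠ c := fun h => hne (h ▸ rfl)
      have h₁ := hM x hxc
      have h₂ : score α (M.map F) x.castSucc ≤ score α M x := by
        simp only [score, List.map_map]
        refine List.sum_le_sum fun v _ => ?_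
        rw [← hext m (hm2 x hxc)]
        exact hanti _ (hF v x hxc)
      have h₃ : score α M c ≤ M.length * a₁ := score_le fun v _ => by
        rw [← hext m (hm2 x hxc)]
        exact hle₁ _ (by simp)
      -- Settles the case that the truncated subtraction makes `g x` zero: the manipulators cannot
      -- lift `x` beyond `S + t * a₀`, which `c` exceeds.
      have h₄ : score α (M.map F) x.castSucc ≤ (M.map F).length * a₀ :=
        score_le fun v _ => hle₀ _
      rw [List.length_map] at h₄
      have h₅ := hx x hxc
      rw [hP, hP, hFc]
      omega
  · rintro ⟨M, rfl, hM⟩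
    choose F hF₀ hF using exists_vote_restrict c
    refine ⟨M.map F, by simp, fun x hxc => ?_⟩
    have h₁ := hM x.castSucc fun h => hxc (Fin.castSucc_injective m h)
    have h₂ : score α (M.map F) x ≤ score α M x.castSucc := by
      simp only [score, List.map_map]
      refine List.sum_le_sum fun v _ => ?_
      rw [Function.comp_apply, ← hext m (hm2 x hxc)]
      exact hanti _ (hF v x hxc)
    have hFc : score α (M.map F) c = M.length * a₁ := by
      simp only [score, List.map_map]
      rw [List.map_congr_left (g := fun _ => a₁) fun v _ => by
        rw [Function.comp_apply, ← hext m (hm2 x hxc)]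
        exact ha₁ _ (by simp [hF₀ v])]
      simp
    -- Excludes the upper cut-off: `c` gets at most `g c + t * a₀ < 2 * (t * a₀ + 1)` above `S`, so
    -- it could not beat such an `x`.
    have h₃ : score α M c.castSucc ≤ M.length * a₀ := score_le fun v _ => hle₀ _
    have h₅ := hx x hxc
    rw [hP, hP] at h₁
    rw [hFc]
    omega

end Voting

/-! ### The kernelization algorithm: parsing, running time, correctness and size. -/

namespace Voting

open StackProgram Turing

/-! ### Reading and writing rows of numbers -/

/-- The state of the parser: the complete rows, the complete entries of the last row, the ticks
read since then, and whether the input is well-formed so far. -/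
abbrev ParseState : Type := List (List ℕ) × List ℕ × ℕ × Bool

/-- Read one symbol; `none` is ignored. -/
def parseStep (s : ParseState) (z : Label) : ParseState :=
  bif decide (z = some .tick) then (s.1, s.2.1, s.2.2.1 + 1, s.2.2.2)
  else bif decide (z = some .comma) then (s.1, s.2.1 ++ [s.2.2.1], 0, s.2.2.2)
  else bif decide (z = some .semi) then
    (s.1 ++ [s.2.1], [], 0, s.2.2.2 && decide (s.2.2.1 = 0))
  else s

/-- Parse a string of rows. -/
def parse (w : List Label) : ParseState := w.foldl parseStep ([], [], 0, true)

/-- Whether parsing was successful. -/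
def ParseState.ok (s : ParseState) : Bool :=
  s.2.2.2 && (decide (s.2.2.1 = 0) && s.2.1.isEmpty)

theorem foldl_parseStep_replicate_none (k : ℕ) (s : ParseState) :
    (List.replicate k none).foldl parseStep s = s := by
  induction k with
  | zero => rfl
  | succ k ih => rw [List.replicate_succ, List.foldl_cons]; exact ih

theorem foldl_parseStep_encodeNat (n k : ℕ) (R : List (List ℕ)) (r : List ℕ) (b : Bool) :
    ((encodeNat n).map some).foldl parseStep (R, r, k, b) = (R, r ++ [k + n], 0, b) := by
  induction n generalizing k with
  | zero => rfl
  | succ n ih =>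
    have := ih (k + 1)
    rw [show k + 1 + n = k + (n + 1) by omega] at this
    have e : parseStep (R, r, k, b) (some .tick) = (R, r, k + 1, b) := rfl
    simpa [encodeNat, List.replicate_succ, e] using this

theorem foldl_parseStep_encodeRow (l : List ℕ) (R : List (List ℕ)) (b : Bool) :
    ((encodeRow l).map some).foldl parseStep (R, [], 0, b) = (R ++ [l], [], 0, b) := by
  have key : ∀ l r : List ℕ, ((l.flatMap encodeNat).map some).foldl parseStep (R, r, 0, b) =
      (R, r ++ l, 0, b) := by
    intro l
    induction l with
    | nil => simp
    | cons n l ih =>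
      intro r
      rw [List.flatMap_cons, List.map_append, List.foldl_append, foldl_parseStep_encodeNat, ih]
      simp
  rw [encodeRow, List.map_append, List.foldl_append, key]
  simp [parseStep]

theorem foldl_parseStep_rows (L R : List (List ℕ)) (b : Bool) :
    ((L.flatMap encodeRow).map some).foldl parseStep (R, [], 0, b) = (R ++ L, [], 0, b) := by
  induction L generalizing R with
  | nil => simp
  | cons l L ih =>
    rw [List.flatMap_cons, List.map_append, List.foldl_append, foldl_parseStep_encodeRow, ih]
    simp

theorem parse_encodePair (x : List Sym) (k : ℕ) :
    parse (Kernelization.encodePair (x, k)) = parse (x.map some) := by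
  rw [parse, Kernelization.encodePair, List.foldl_append, foldl_parseStep_replicate_none, parse]

theorem parse_rows (L : List (List ℕ)) :
    parse ((L.flatMap encodeRow).map some) = (L, [], 0, true) := by
  simpa [parse] using foldl_parseStep_rows L [] true

/-- As long as the flag holds, the state determines the string read so far. A string that passes all
tests is therefore literally the encoding of an instance. -/
theorem eq_of_parse (x : List Sym) (h : (parse (x.map some)).2.2.2 = true) :
    x = (parse (x.map some)).1.flatMap encodeRow ++
      ((parse (x.map some)).2.1.flatMap encodeNat ++
        List.replicate (parse (x.map some)).2.2.1 Sym.tick) := by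
  induction x using List.reverseRecOn with
  | nil => rfl
  | append_singleton x z ih =>
    have e : parse ((x ++ [z]).map some) = parseStep (parse (x.map some)) (some z) := by
      simp [parse]
    rw [e] at h ⊢
    generalize parse (x.map some) = s at *
    obtain ⟨R, r, n, b⟩ := s
    cases z
    · simp only [parseStep] at h ⊢
      simp at h ih ⊢
      rw [ih h, List.replicate_succ']
      simp
    · simp only [parseStep] at h ⊢
      simp at h ih ⊢
      rw [ih h]
      simp [encodeNat]
    · simp only [parseStep] at h ⊢
      simp at h ih ⊢
      obtain ⟨h, rfl⟩ := h
      rw [ih h]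
      simp [encodeRow]

theorem eq_of_parse_ok {x : List Sym} (h : (parse (x.map some)).ok = true) :
    x = (parse (x.map some)).1.flatMap encodeRow := by
  simp only [ParseState.ok, Bool.and_eq_true, decide_eq_true_eq, List.isEmpty_iff] at h
  have := eq_of_parse x h.1
  rw [h.2.1, h.2.2] at this
  simpa using this

theorem length_encodeRow (l : List ℕ) : (encodeRow l).length = l.sum + l.length + 1 := by
  have : (l.flatMap encodeNat).length = l.sum + l.length := by
    induction l with
    | nil => rfl
    | cons n l ih =>
      rw [List.flatMap_cons, List.length_append, ih]
      simp [encodeNat]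
      ring
  simp [encodeRow, this]

section

variable {T : TM2ComputableAux Sym Sym} {X : Type} [Enc X]

open PolyTime

theorem polyTime_parse {f : X → List Label} (hf : PolyTime T f) :
    PolyTime T fun x => parse (f x) := by
  have hs : PolyTime T fun y : X × ParseState × Label => y.2.1 := fst.comp snd
  have hz : PolyTime T fun y : X × ParseState × Label => y.2.2 := snd.comp snd
  have h₁ := fst.comp hs
  have h₂ := fst.comp (snd.comp hs)
  have h₃ := fst.comp (snd.comp (snd.comp hs))
  have h₄ := snd.comp (snd.comp (snd.comp hs))
  refine foldl_of_add (h := fun y => parseStep y.2.1 y.2.2) hf (const _) (.cond (hz.eq_label _)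
    (h₁.pair (h₂.pair (h₃.succ.pair h₄))) (.cond (hz.eq_label _)
    (h₁.pair ((h₂.append (h₃.cons (const []))).pair ((const 0).pair h₄)))
    (.cond (hz.eq_label _) ((h₁.append (h₂.cons (const []))).pair
    ((const []).pair ((const 0).pair (h₄.and h₃.isZero)))) hs))) 10 fun x b z _ => ?_
  obtain ⟨R, r, n, b⟩ := b
  have e₁ := esize_append r [n]
  have e₂ := esize_append R [r]
  simp only [esize_cons, esize_nil, esize_nat] at e₁ e₂
  simp only [parseStep, Polynomial.eval_ofNat]
  cases decide (z = some .tick) <;> cases decide (z = some .comma) <;>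
    cases decide (z = some .semi) <;>
    simp only [cond_true, cond_false, esize_prod, esize_nat, esize_bool, esize_nil] <;> omega

theorem polyTime_ok {f : X → ParseState} (hf : PolyTime T f) :
    PolyTime T fun x => (f x).ok :=
  (snd.comp (snd.comp (snd.comp hf))).and
    ((fst.comp (snd.comp (snd.comp hf))).isZero.and (fst.comp (snd.comp hf)).isEmpty)

theorem polyTime_encodeRow {f : X → List ℕ} (hf : PolyTime T f) :
    PolyTime T fun x => ((encodeRow (f x)).map some : List Label) := by
  have := (flatMap hf ((snd.replicate (const (some Sym.tick : Label))).append
    (const [(some Sym.comma : Label)]))).append (const [(some Sym.semi : Label)])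
  convert this using 2 with x
  simp [encodeRow, List.map_flatMap, encodeNat]

/-- The oracle delivers the vector as a string, from which the parser recovers the list. The bound
on the entries bounds the length of this unary string. -/
theorem polyTime_ofFn_of_computable {α : ScoreVectors} {p : Polynomial ℕ}
    (hp : ∀ m i, α m i ≤ p.eval m)
    (h : TM2ComputableInPolyTime (fun m : ℕ => List.replicate m Sym.tick) encodeRow
      fun m : ℕ => List.ofFn (α m)) :
    PolyTime h.toTM2ComputableAux fun m : ℕ => List.ofFn (α m) := by
  have := PolyTime.oracle h (Polynomial.X * p + Polynomial.X + 1) fun m => by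
    have hs := List.sum_le_card_nsmul (List.ofFn (α m)) (p.eval m) (by
      simp only [List.mem_ofFn]
      rintro _ ⟨i, rfl⟩
      exact hp m i)
    rw [length_encodeRow]
    simpa using hs
  have := (fst.comp (polyTime_parse this.reverse)).headD []
  convert this using 2 with m
  rw [List.reverse_reverse]
  have e := parse_rows [List.ofFn (α m)]
  rw [List.flatMap_cons, List.flatMap_nil, List.append_nil] at e
  rw [e, List.headD_cons]

end

/-! ### The kernelization -/

/-- The score of `x`, if each candidate gets the score of the position after its own. -/
def listScore (a : List ℕ) (votes : List (List ℕ)) (x : ℕ) : ℕ :=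
  (votes.map fun r => a.getD (r.idxOf x + 1) 0).sum

/-- The number of points that the votes of the kernel give to the candidate `x` in addition to a
number of points that does not depend on `x`. -/
def bonus (a : List ℕ) (t c : ℕ) (votes : List (List ℕ)) (x : ℕ) : ℕ :=
  bif decide (x = c) then t * a.getD 0 0 + 1 - t * (a.getD 0 0 - a.getD 1 0)
  else min (listScore a votes x + (t * a.getD 0 0 + 1) - listScore a votes c)
    (2 * (t * a.getD 0 0 + 1))

/-- The votes of the kernel. -/
def kernelVotes (a : List ℕ) (k t c : ℕ) (votes : List (List ℕ)) : List (List ℕ) :=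
  (List.range k).flatMap fun x =>
    (List.range (bonus a t c votes x)).flatMap fun _ => raise k x

/-- Whether a row is a vote on `k` candidates. -/
def isVoteRow (k : ℕ) (r : List ℕ) : Bool :=
  decide (r.length = k) && (List.range k).all fun i => decide (r.idxOf i < r.length)

/-- The parameter in an input. -/
def param (w : List Label) : ℕ := (w.filter fun z => decide (z = none)).length

/-- The first row of an input. -/
def header (w : List Label) : List ℕ := (parse w).1.headD []

/-- The other rows of an input. -/
def voteRows (w : List Label) : List (List ℕ) := (parse w).1.tail

/-- Whether an input encodes an instance with at most `q m` manipulators. -/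
def isInstance (q : Polynomial ℕ) (w : List Label) : Bool :=
  (parse w).ok && (decide ((header w).length = 3) &&
    (decide ((header w).getD 0 0 = param w) && (decide ((header w).getD 2 0 < param w) &&
    (decide ((header w).getD 1 0 ≤ q.eval (param w)) &&
    (voteRows w).all fun r => isVoteRow (param w) r))))

/-- The rows of the kernel. -/
def kernelRows (α : ScoreVectors) (w : List Label) : List (List ℕ) :=
  [param w + 1, (header w).getD 1 0, (header w).getD 2 0] ::
    kernelVotes (List.ofFn (α (param w + 1))) (param w) ((header w).getD 1 0)
      ((header w).getD 2 0) (voteRows w)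

/-- The kernelization. -/
def kernel (α : ScoreVectors) (q : Polynomial ℕ) (y : List Sym × ℕ) : List Sym × ℕ :=
  bif isInstance q (Kernelization.encodePair y) then
    ((kernelRows α (Kernelization.encodePair y)).flatMap encodeRow, y.2 + 1)
  -- A fixed no-instance: without candidates there is no `c`.
  else ([], 0)

section

variable {T : TM2ComputableAux Sym Sym} {X : Type} [Enc X]

open PolyTime

theorem polyTime_raise {k x : X → ℕ} (hk : PolyTime T k) (hx : PolyTime T x) :
    PolyTime T fun y => raise (k y) (x y) := by
  have ho : PolyTime T fun y => others (k y) (x y) := by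
    have := filter hk.range (snd.eq_nat (hx.comp fst)).not
    simpa only [others, ne_eq, decide_not] using this
  exact (ho.append (hx.cons (hk.cons (const [])))).cons (map hk.range
    (((ho.append (hk.cons (hx.cons (const [])))).comp fst).rotate snd.succ))

theorem polyTime_listScore {a : X → List ℕ} {v : X → List (List ℕ)} {x : X → ℕ}
    (ha : PolyTime T a) (hv : PolyTime T v) (hx : PolyTime T x) :
    PolyTime T fun y => listScore (a y) (v y) (x y) :=
  (map hv ((ha.comp fst).getD (snd.idxOf (hx.comp fst)).succ 0)).sum

theorem polyTime_bonus {a : X → List ℕ} {t c x : X → ℕ} {v : X → List (List ℕ)}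
    (ha : PolyTime T a) (ht : PolyTime T t) (hc : PolyTime T c) (hv : PolyTime T v)
    (hx : PolyTime T x) : PolyTime T fun y => bonus (a y) (t y) (c y) (v y) (x y) := by
  have h₀ := ha.getD (const 0) 0
  have hL := (ht.mul h₀).succ
  exact .cond (hx.eq_nat hc) (hL.sub (ht.mul (h₀.sub (ha.getD (const 1) 0))))
    ((((polyTime_listScore ha hv hx).add hL).sub (polyTime_listScore ha hv hc)).min
      ((const 2).mul hL))

theorem polyTime_kernelVotes {a : X → List ℕ} {k t c : X → ℕ} {v : X → List (List ℕ)}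
    (ha : PolyTime T a) (hk : PolyTime T k) (ht : PolyTime T t) (hc : PolyTime T c)
    (hv : PolyTime T v) : PolyTime T fun y => kernelVotes (a y) (k y) (t y) (c y) (v y) :=
  flatMap hk.range (flatMap (polyTime_bonus (ha.comp fst) (ht.comp fst) (hc.comp fst)
    (hv.comp fst) snd).range (polyTime_raise ((hk.comp fst).comp fst) (snd.comp fst)))

theorem polyTime_param : PolyTime T param :=
  (filter PolyTime.id (snd.eq_label none)).length

theorem polyTime_header : PolyTime T header := (fst.comp (polyTime_parse .id)).headD []

theorem polyTime_voteRows : PolyTime T voteRows := tail.comp (fst.comp (polyTime_parse .id))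

theorem polyTime_isInstance (q : Polynomial ℕ) : PolyTime T (isInstance q) :=
  (polyTime_ok (polyTime_parse .id)).and <|
    (polyTime_header.length.eq_nat (const 3)).and <|
    ((polyTime_header.getD (const 0) 0).eq_nat polyTime_param).and <|
    ((polyTime_header.getD (const 2) 0).lt polyTime_param).and <|
    ((polyTime_header.getD (const 1) 0).le (polyTime_param.polynomial_eval q)).and <|
    all polyTime_voteRows <| (snd.length.eq_nat (polyTime_param.comp fst)).and <|
    all (polyTime_param.comp fst).range <| ((snd.comp fst).idxOf snd).lt (snd.comp fst).length

theorem polyTime_kernelRows {α : ScoreVectors} (hα : PolyTime T fun m : ℕ => List.ofFn (α m)) :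
    PolyTime T (kernelRows α) :=
  (polyTime_param.succ.cons ((polyTime_header.getD (const 1) 0).cons
    ((polyTime_header.getD (const 2) 0).cons (const [])))).cons <|
  polyTime_kernelVotes (hα.comp polyTime_param.succ) polyTime_param
    (polyTime_header.getD (const 1) 0) (polyTime_header.getD (const 2) 0) polyTime_voteRows

theorem param_encodePair (y : List Sym × ℕ) : param (Kernelization.encodePair y) = y.2 := by
  simp [param, Kernelization.encodePair, List.filter_map, Function.comp_def]

theorem kernel_computable {α : ScoreVectors} (hα : PolyTime T fun m : ℕ => List.ofFn (α m))
    (q : Polynomial ℕ) :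
    Nonempty (TM2ComputableInPolyTime (Kernelization.encodePair (Γ := Sym))
      (Kernelization.encodePair (Γ := Sym)) (kernel α q)) := by
  have hF : PolyTime T fun w => bif isInstance q w then
      List.replicate (param w + 1) none ++
        (kernelRows α w).flatMap fun r => ((encodeRow r).map some : List Label)
      else [] :=
    (polyTime_isInstance q).cond ((polyTime_param.succ.replicate (const none)).append
      (flatMap (polyTime_kernelRows hα) (polyTime_encodeRow snd))) (const [])
  refine (hF.comp (PolyTime.id.reverse)).reverse.nonempty_computable fun y => ?_
  simp only [List.reverse_reverse, kernel]
  cases isInstance q (Kernelization.encodePair y)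
  · rfl
  · simp only [cond_true, param_encodePair]
    simp [Kernelization.encodePair, List.map_flatMap]

end

/-! ### Correctness of the kernelization -/

theorem CMInstance.encode_eq (I : CMInstance) :
    I.encode = ([I.m, I.numManip, (I.c : ℕ)] :: I.votes.map Vote.row).flatMap encodeRow := by
  simp [CMInstance.encode, Vote.row, List.flatMap_map]

theorem CMInstance.parse_encode (I : CMInstance) (k : ℕ) :
    parse (Kernelization.encodePair (I.encode, k)) =
      ([I.m, I.numManip, (I.c : ℕ)] :: I.votes.map Vote.row, [], 0, true) := by
  rw [parse_encodePair, CMInstance.encode_eq, parse_rows]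

theorem Vote.row_injective {m : ℕ} : Function.Injective (Vote.row (m := m)) := fun v w h => by
  have := List.ofFn_injective h
  exact Equiv.ext fun i => Fin.ext (congrFun this i)

theorem CMInstance.encode_injective : Function.Injective CMInstance.encode := fun I J h => by
  have hI := I.parse_encode 0
  rw [h, J.parse_encode] at hI
  obtain ⟨m, P, t, c⟩ := I
  obtain ⟨m', P', t', c'⟩ := J
  simp only [Prod.mk.injEq, List.cons.injEq, and_true] at hI
  obtain ⟨⟨rfl, rfl, hc⟩, hP⟩ := hI
  obtain rfl := Fin.ext hc
  obtain rfl := List.map_injective_iff.2 Vote.row_injective hP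
  rfl

/-- An encoding determines its instance, so no other instance can witness membership. -/
theorem mem_coalitionalManipulation {r : Rule} {q : Polynomial ℕ} {I : CMInstance}
    (h : I.numManip ≤ q.eval I.m) :
    (I.encode, I.m) ∈ coalitionalManipulation r q ↔ I.IsYes r := by
  constructor
  · rintro ⟨J, hJ, -, -, hy⟩
    rwa [CMInstance.encode_injective hJ] at hy
  · exact fun hy => ⟨I, rfl, rfl, h, hy⟩

theorem isVoteRow_iff {k : ℕ} {r : List ℕ} :
    isVoteRow k r = true ↔ ∃ v : Vote k, v.row = r := by
  simp only [isVoteRow, Bool.and_eq_true, decide_eq_true_eq, List.all_eq_true, List.mem_range,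
    List.idxOf_lt_length_iff]
  constructor
  · exact fun h => exists_vote_of_row h.1 h.2
  · rintro ⟨v, rfl⟩
    exact ⟨v.length_row, fun _ => v.mem_row⟩

theorem exists_of_isInstance {q : Polynomial ℕ} {y : List Sym × ℕ}
    (h : isInstance q (Kernelization.encodePair y) = true) :
    ∃ I : CMInstance, I.encode = y.1 ∧ I.m = y.2 ∧ I.numManip ≤ q.eval I.m := by
  obtain ⟨x, k⟩ := y
  simp only [isInstance, header, voteRows, param_encodePair, parse_encodePair, Bool.and_eq_true,
    decide_eq_true_eq, List.all_eq_true, isVoteRow_iff] at h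
  obtain ⟨hok, hlen, hm, hc, ht, hv⟩ := h
  have hx := eq_of_parse_ok hok
  generalize (parse (x.map some)).1 = L at *
  match L, hlen, hm, hc, ht, hv, hx with
  | [m, t, c] :: R, _, hm, hc, ht, hv, hx =>
    simp only [List.headD_cons, List.tail_cons, List.getD_cons_zero, List.getD_cons_succ] at *
    choose! F hF using hv
    subst hm
    refine ⟨⟨m, R.map F, t, ⟨c, hc⟩⟩, ?_, rfl, ht⟩
    rw [CMInstance.encode_eq, hx, List.map_map]
    congr 2
    exact (List.map_congr_left (g := id) fun r hr => hF r hr).trans (List.map_id _)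

theorem isInstance_encode {q : Polynomial ℕ} {I : CMInstance} (h : I.numManip ≤ q.eval I.m) :
    isInstance q (Kernelization.encodePair (I.encode, I.m)) = true := by
  simp only [isInstance, header, voteRows, param_encodePair, I.parse_encode, Bool.and_eq_true,
    decide_eq_true_eq, List.all_eq_true, isVoteRow_iff, ParseState.ok]
  refine ⟨⟨trivial, trivial, rfl⟩, rfl, rfl, I.c.2, h, fun r hr => ?_⟩
  obtain ⟨v, -, rfl⟩ := List.mem_map.1 hr
  exact ⟨v, rfl⟩

section

variable {α : ScoreVectors}

theorem getD_ofFn {n : ℕ} (f : Fin n → ℕ) (i : Fin n) : (List.ofFn f).getD i 0 = f i := by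
  simp [List.getD_eq_getElem?_getD]

/-- Shifted by one, the vector for `m + 1` candidates is the vector for `m`, so the kernelization
needs only the former. On genuine votes the shifted index is in range and the default `0` plays no
role. -/
theorem listScore_eq (hext : ∀ m, 2 ≤ m → ∀ i : Fin m, α (m + 1) i.succ = α m i) {m : ℕ}
    (hm : 2 ≤ m) (P : List (Vote m)) (x : Fin m) :
    listScore (List.ofFn (α (m + 1))) (P.map Vote.row) x = score α P x := by
  simp only [listScore, score, List.map_map]
  congr 1
  refine List.map_congr_left fun v _ => ?_
  rw [Function.comp_apply, v.idxOf_row, ← hext m hm]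
  exact getD_ofFn (α (m + 1)) (v.symm x).succ

/-- Each copy of the block for `x` adds the sum of the vector to all old candidates, plus one point
for `x`, so `S` is that sum times the number of blocks. The dummy falls one point short in each
block. -/
theorem exists_votes_kernelVotes (h₁ : ∀ n, α (n + 2) (Fin.last (n + 1)) = 0)
    (h₂ : ∀ n, α (n + 2) (Fin.last n).castSucc = 1) (a : List ℕ) (m t c : ℕ)
    (R : List (List ℕ)) :
    ∃ (P : List (Vote (m + 1))) (S : ℕ), P.map Vote.row = kernelVotes a m t c R ∧
      (∀ x : Fin m, score α P x.castSucc = S + bonus a t c R x) ∧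
      score α P (Fin.last m) ≤ S := by
  choose V hV hx hl using fun x : Fin m => exists_votes_raise h₁ h₂ x
  have hs : ∀ y, score α ((List.finRange m).flatMap fun x : Fin m =>
      (List.range (bonus a t c R x)).flatMap fun _ => V x) y =
      ∑ x : Fin m, bonus a t c R x * score α (V x) y := fun y => by
    rw [score_flatMap, Fin.sum_univ_def]
    congr 1
    refine List.map_congr_left fun x _ => ?_
    rw [score_flatMap]
    simp
  refine ⟨(List.finRange m).flatMap fun x : Fin m =>
    (List.range (bonus a t c R x)).flatMap fun _ => V x,
    (∑ x : Fin m, bonus a t c R x) * ∑ i, α (m + 1) i, ?_, fun y => ?_, ?_⟩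
  · simp only [List.map_flatMap, hV, kernelVotes]
    rw [← List.map_coe_finRange_eq_range, List.flatMap_map]
  · rw [hs]
    simp only [hx, Nat.mul_add, Finset.sum_add_distrib, Finset.sum_mul]
    simp
  · rw [hs, Finset.sum_mul]
    refine Finset.sum_le_sum fun x _ => Nat.mul_le_mul_left _ ?_
    have := hl x
    omega

/-- The cut-off bounds every bonus independently of `R`, so the number of original votes disappears
from the size. A block consists of `m + 1` votes. -/
theorem length_kernelVotes_le (a : List ℕ) (m t c : ℕ) (R : List (List ℕ)) :
    (kernelVotes a m t c R).length ≤ m * (2 * (t * a.getD 0 0 + 1) * (m + 1)) := by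
  have hb : ∀ x, bonus a t c R x ≤ 2 * (t * a.getD 0 0 + 1) := fun x => by
    rw [bonus]
    cases decide (x = c) <;> simp only [cond_true, cond_false] <;> omega
  have := List.sum_le_card_nsmul ((List.range m).map fun x => bonus a t c R x * (m + 1))
    (2 * (t * a.getD 0 0 + 1) * (m + 1)) (by
      simp only [List.mem_map, List.mem_range]
      rintro _ ⟨x, -, rfl⟩
      exact Nat.mul_le_mul_right _ (hb x))
  simpa [kernelVotes, List.length_flatMap, raise] using this

theorem length_encode_le (I : CMInstance) :
    I.encode.length ≤ 2 * I.m + I.numManip + 4 + I.votes.length * (I.m * I.m + I.m + 1) := by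
  have hrow : ∀ v : Vote I.m, (encodeRow v.row).length ≤ I.m * I.m + I.m + 1 := fun v => by
    have := List.sum_le_card_nsmul v.row I.m (by
      simp only [Vote.row, List.mem_ofFn]
      rintro _ ⟨i, rfl⟩
      exact (v i).2.le)
    rw [length_encodeRow]
    simpa using this
  have hsum := List.sum_le_card_nsmul (I.votes.map fun v => (encodeRow v.row).length)
    (I.m * I.m + I.m + 1) (by
      simp only [List.mem_map]
      rintro _ ⟨v, -, rfl⟩
      exact hrow v)
  have hc := I.c.2
  rw [CMInstance.encode_eq, List.flatMap_cons, List.length_append, length_encodeRow,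
    List.flatMap_map, List.length_flatMap]
  simp only [List.length_map, smul_eq_mul, List.sum_cons, List.sum_nil, List.length_cons,
    List.length_nil] at hsum ⊢
  omega

/-- The kernel of the encoding of an instance. -/
theorem exists_kernel_eq (hanti : ∀ m, Antitone (α m))
    (hext : ∀ m, 2 ≤ m → ∀ i : Fin m, α (m + 1) i.succ = α m i)
    (h₁ : ∀ n, α (n + 2) (Fin.last (n + 1)) = 0)
    (h₂ : ∀ n, α (n + 2) (Fin.last n).castSucc = 1) {q : Polynomial ℕ} {I : CMInstance}
    (hq : I.numManip ≤ q.eval I.m) :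
    ∃ J : CMInstance, kernel α q (I.encode, I.m) = (J.encode, J.m) ∧ J.m = I.m + 1 ∧
      J.numManip = I.numManip ∧
      J.votes.length ≤ I.m * (2 * (I.numManip * α (I.m + 1) 0 + 1) * (I.m + 1)) ∧
      (I.IsYes (scoringRule α) ↔ J.IsYes (scoringRule α)) := by
  have hinst := isInstance_encode hq
  obtain ⟨m, P, t, c⟩ := I
  obtain ⟨P', S, hP', hS, hl⟩ := exists_votes_kernelVotes h₁ h₂ (List.ofFn (α (m + 1))) m t c
    (P.map Vote.row)
  have ha₀ : (List.ofFn (α (m + 1))).getD 0 0 = α (m + 1) 0 := getD_ofFn (α (m + 1)) 0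
  have ha₁ : (List.ofFn (α (m + 1))).getD 1 0 = α (m + 1) ⟨1, by have := c.pos; omega⟩ :=
    getD_ofFn (α (m + 1)) ⟨1, by have := c.pos; omega⟩
  refine ⟨⟨m + 1, P', t, c.castSucc⟩, ?_, rfl, rfl, ?_, ?_⟩
  · have hk : ∀ w, param w = m → (parse w).1 = [m, t, (c : ℕ)] :: P.map Vote.row →
        kernelRows α w = [m + 1, t, (c : ℕ)] ::
          kernelVotes (List.ofFn (α (m + 1))) m t c (P.map Vote.row) := fun w hw hp => by
      simp only [kernelRows, header, voteRows, hp]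
      rw [hw]
      rfl
    rw [kernel, hinst, cond_true, hk _ (param_encodePair _) (by rw [CMInstance.parse_encode]), ← hP',
      CMInstance.encode_eq ⟨m + 1, P', t, c.castSucc⟩]
    rfl
  · have := length_kernelVotes_le (List.ofFn (α (m + 1))) m t c (P.map Vote.row)
    rw [← hP', List.length_map, ha₀] at this
    exact this
  · refine isYes_iff hanti hext (a₀ := α (m + 1) 0) (a₁ := (List.ofFn (α (m + 1))).getD 1 0)
      (fun i hi => congrArg _ (Fin.ext hi)) (fun i hi => ?_) hS hl ?_ fun x hx => ?_
    · rw [ha₁]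
      exact congrArg _ (Fin.ext hi)
    · simp only [bonus, decide_true, cond_true, ha₀]
    · have hm : 2 ≤ m := by
        have := Fin.val_ne_of_ne hx
        omega
      have hne : decide ((x : ℕ) = c) = false := decide_eq_false (Fin.val_ne_of_ne hx)
      simp only [bonus, hne, cond_false, ha₀, listScore_eq hext hm]

theorem hasPolynomialKernel {T : TM2ComputableAux Sym Sym} (hanti : ∀ m, Antitone (α m))
    (hext : ∀ m, 2 ≤ m → ∀ i : Fin m, α (m + 1) i.succ = α m i)
    (h₁ : ∀ n, α (n + 2) (Fin.last (n + 1)) = 0)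
    (h₂ : ∀ n, α (n + 2) (Fin.last n).castSucc = 1) {p : Polynomial ℕ}
    (hp : ∀ m i, α m i ≤ p.eval m) (hα : PolyTime T fun m : ℕ => List.ofFn (α m))
    (q : Polynomial ℕ) :
    Kernelization.HasPolynomialKernel (coalitionalManipulation (scoringRule α) q) := by
  have hno : ∀ y : List Sym × ℕ, isInstance q (Kernelization.encodePair y) = false →
      kernel α q y = ([], 0) := fun y hy => by rw [kernel, hy, cond_false]
  let X : Polynomial ℕ := Polynomial.X
  refine ⟨kernel α q, kernel_computable hα q, fun y => ?_,
    -- `length_encode_le` for `m + 1` candidates, with `q` bounding the number of manipulators and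
    -- `p` at `m + 1` bounding the top score. The new parameter `m + 1` is covered by the first
    -- summand.
    2 * (X + 1) + q + 4 + X * (2 * (q * p.comp (X + 1) + 1) * (X + 1)) *
      ((X + 1) * (X + 1) + (X + 1) + 1), fun y => ?_⟩
  · cases hy : isInstance q (Kernelization.encodePair y)
    · rw [hno y hy]
      constructor
      · rintro ⟨I, hI, hm, hq, -⟩
        have := isInstance_encode hq
        rw [hI, hm, hy] at this
        cases this
      · rintro ⟨I, -, hm, -⟩
        exact absurd I.c.pos (by rw [hm]; simp)
    · obtain ⟨I, hI, hm, hq⟩ := exists_of_isInstance hy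
      obtain rfl : (I.encode, I.m) = y := Prod.ext hI hm
      obtain ⟨J, hJ, hJm, hJt, -, hiff⟩ := exists_kernel_eq hanti hext h₁ h₂ hq
      rw [hJ, mem_coalitionalManipulation hq, hiff, mem_coalitionalManipulation]
      rw [hJt, hJm]
      exact hq.trans (eval_mono q (Nat.le_succ _))
  · cases hy : isInstance q (Kernelization.encodePair y)
    · rw [hno y hy]
      exact ⟨Nat.zero_le _, Nat.zero_le _⟩
    · obtain ⟨I, hI, hm, hq⟩ := exists_of_isInstance hy
      obtain rfl : (I.encode, I.m) = y := Prod.ext hI hm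
      obtain ⟨J, hJ, hJm, hJt, hJv, -⟩ := exists_kernel_eq hanti hext h₁ h₂ hq
      have hlen := length_encode_le J
      have hv : J.votes.length ≤
          I.m * (2 * (q.eval I.m * p.eval (I.m + 1) + 1) * (I.m + 1)) := by
        refine hJv.trans ?_
        gcongr
        exact hp _ _
      have hv' := Nat.mul_le_mul_right ((I.m + 1) * (I.m + 1) + (I.m + 1) + 1) hv
      rw [hJ]
      generalize J.votes.length = n at hlen hv'
      rw [hJm, hJt] at hlen
      simp only [hJm]
      simp only [X, Polynomial.eval_add, Polynomial.eval_mul, Polynomial.eval_X,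
        Polynomial.eval_one, Polynomial.eval_ofNat, Polynomial.eval_comp]
      omega

end

/-- The only normalized vector of length two is `(1, 0)`, and extension adds entries only in front,
so this ending persists. -/
theorem IsPolyExtensible.last {α : ScoreVectors} (h : IsPolyExtensible α) (n : ℕ) :
    α (n + 2) (Fin.last (n + 1)) = 0 ∧ α (n + 2) (Fin.last n).castSucc = 1 := by
  induction n with
  | zero =>
    obtain ⟨j, k, hk, hjk, h0⟩ := h.normalized 2 le_rfl
    obtain rfl : j = 0 := by omega
    obtain rfl : k = 1 := by omega
    have h1 := h0 1 (by decide)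
    rw [h1] at hjk
    exact ⟨h1, hjk⟩
  | succ n ih =>
    have h₁ := h.extension (n + 2) (by omega) (Fin.last (n + 1))
    have h₂ := h.extension (n + 2) (by omega) (Fin.last n).castSucc
    exact ⟨h₁.trans ih.1, h₂.trans ih.2⟩

theorem polyTime_ofFn_borda {T : TM2ComputableAux Sym Sym} :
    PolyTime T fun m : ℕ => List.ofFn (bordaVectors m) := by
  have := (PolyTime.id (T := T) (X := ℕ)).range.reverse
  convert this using 2 with m
  refine List.ext_getElem (by simp) fun i h₁ h₂ => ?_
  simp [bordaVectors]

end Voting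

theorem theorem6 :
    (∀ q : Polynomial ℕ, Kernelization.HasPolynomialKernel
      (Voting.coalitionalManipulation Voting.borda q)) ∧
    (∀ α : Voting.ScoreVectors, Voting.IsPolyExtensible α → ∀ q : Polynomial ℕ,
      Kernelization.HasPolynomialKernel
        (Voting.coalitionalManipulation (Voting.scoringRule α) q)) := by
  refine ⟨fun q => ?_, fun α h q => ?_⟩
  · refine Voting.hasPolynomialKernel
      -- Borda vectors are computed without an oracle, so any machine can fill its place.
      (T := ⟨Turing.idComputer Voting.Sym, Equiv.refl _, Equiv.refl _⟩) (p := Polynomial.X)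
      (fun m i j hij => ?_) (fun m _ i => ?_) (fun n => ?_) (fun n => ?_) (fun m i => ?_)
      Voting.polyTime_ofFn_borda q
    · have : (i : ℕ) ≤ j := hij
      simp only [Voting.bordaVectors]
      omega
    · simp only [Voting.bordaVectors, Fin.val_succ]
      omega
    · simp [Voting.bordaVectors]
    · simp [Voting.bordaVectors]
    · simp only [Voting.bordaVectors, Polynomial.eval_X]
      omega
  · obtain ⟨p, hp⟩ := h.polyBounded
    have hp' : ∀ m i, α m i ≤ p.eval m := fun m i =>
      (h.antitone m (show ⟨0, i.pos⟩ ≤ i from Nat.zero_le _)).trans (hp m i.pos)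
    exact Voting.hasPolynomialKernel h.antitone h.extension (fun n => (h.last n).1)
      (fun n => (h.last n).2) hp' (Voting.polyTime_ofFn_of_computable hp' h.computable.some) q
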